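/- Let $d\in\mathbb N$, let $A\in GL_d(\mathbb{Q})$ have no complex eigenvalue of modulus $1$, and let $H$ be a subgroup of $\mathbb{Q}^d$ with $AH=H$ that spans $\mathbb{Q}^d$ over $\mathbb{Q}$ (that is, $\mathrm{rank}_{\mathbb Q}(H)=d$). Let $G=\mathbb{Z}\ltimes_A H$ be the semidirect product in which the generator $a$ of $\mathbb{Z}$ acts on $H$ by $A$ (so that $aba^{-1}=Ab$ for $b\in H$). Let $\Phi:G\to \mathrm{Diff}^1_+([0,1])$ be a homomorphism into the group of orientation-preserving $C^1$ diffeomorphisms of the closed interval such that $\Phi(G)$ has no global fixed point in $(0,1)$ and is non-Abelian. Then $\Phi$ is topologically conjugate on $(0,1)$ to an affine action: there are a homomorphism $\psi:G\to \mathrm{Aff}_+(\mathbb{R})$ into the group of orientation-preserving affine bijections of $\mathbb{R}$ and a homeomorphism $F:(0,1)\to\mathbb{R}$ with $F\circ\Phi(g)=\psi(g)\circ F$ on $(0,1)$ for all $g\in G$. Moreover, for every such pair $(\psi,F)$, the map $\psi(a)$ is a homothety $t\mapsto c+\lambda(t-c)$ of some ratio $\lambda>0$, $\lambda\neq 1$,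 the diffeomorphism $\Phi(a)$ has exactly one fixed point in $(0,1)$, and the derivative of $\Phi(a)$ at this point equals $\lambda$. More generally, for every integer $k\neq 0$ and every $b\in H$, the diffeomorphism $\Phi(a^k b)$ has exactly one fixed point in $(0,1)$, and its derivative at this point equals $\lambda^k$. -/

import Mathlib

open Set
open scoped unitInterval Matrix MatrixGroups

/-! ### Orientation-preserving `C¹` diffeomorphisms of `[0,1]` -/

/-- A self-map of `[0,1]`, read as a real function of a real variable: it is `f` on `[0,1]`
and is extended by constants outside. -/
noncomputable def realExt (f : I → I) : ℝ → ℝ :=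
  fun x => (f (Set.projIcc (0 : ℝ) 1 zero_le_one x) : ℝ)

theorem realExt_coe (f : I → I) (x : I) : realExt f (x : ℝ) = (f x : ℝ) := by
  simp [realExt]

theorem realExt_mapsTo (f : I → I) : MapsTo (realExt f) (Icc (0 : ℝ) 1) (Icc (0 : ℝ) 1) :=
  fun _ _ => (f _).2

theorem realExt_comp (f g : I → I) : realExt (f ∘ g) = realExt f ∘ realExt g := by
  funext x
  simp [realExt]

theorem realExt_id : EqOn (realExt id) id (Icc (0 : ℝ) 1) := by
  intro x hx
  simp [realExt, Set.projIcc_of_mem zero_le_one hx]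

/-- The group of orientation-preserving `C¹` diffeomorphisms of `[0,1]`: the increasing
homeomorphisms of `[0,1]` that are, together with their inverses, of class `C¹` on the closed
interval (one-sided derivatives at the end points). The group law is composition. -/
def DiffOnePlus : Subgroup (I ≃ₜ I) where
  carrier := {f | StrictMono f ∧ ContDiffOn ℝ 1 (realExt f) (Icc 0 1) ∧
    ContDiffOn ℝ 1 (realExt f.symm) (Icc 0 1)}
  one_mem' := by
    have h : ContDiffOn ℝ 1 (realExt id) (Icc 0 1) := contDiffOn_id.congr realExt_id
    exact ⟨strictMono_id, h, h⟩
  mul_mem' := by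
    rintro f g ⟨hf, hf1, hf2⟩ ⟨hg, hg1, hg2⟩
    refine ⟨hf.comp hg, ?_, ?_⟩
    · have h := hf1.comp hg1 (realExt_mapsTo g)
      rw [← realExt_comp] at h
      exact h
    · have h := hg2.comp hf2 (realExt_mapsTo f.symm)
      rw [← realExt_comp] at h
      exact h
  inv_mem' := by
    rintro f ⟨hf, hf1, hf2⟩
    refine ⟨fun x y hxy => ?_, hf2, hf1⟩
    have h : f (f.symm x) < f (f.symm y) := by simpa using hxy
    exact hf.lt_iff_lt.1 h

/-! ### The orientation-preserving affine group of the line -/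

/-- The group of orientation-preserving affine bijections of the real line, under
composition. -/
def AffPlus : Subgroup (ℝ ≃ᵃ[ℝ] ℝ) where
  carrier := {f | StrictMono f}
  one_mem' := strictMono_id
  mul_mem' := by
    intro f g hf hg x y hxy
    exact hf (hg hxy)
  inv_mem' := by
    intro f hf x y hxy
    have hf' : StrictMono f := hf
    have h : f (f.symm x) < f (f.symm y) := by simpa using hxy
    exact hf'.lt_iff_lt.1 h

/-! ### The groups `ℤ ⋉_A H` -/

/-- A matrix `A ∈ GL_d(ℚ)` as an automorphism of the group `ℚ^d`. -/
noncomputable def glAut {d : ℕ} (A : GL (Fin d) ℚ) : MulAut (Multiplicative (Fin d → ℚ)) :=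
  AddEquiv.toMultiplicative
    { toFun := fun v => (A : Matrix (Fin d) (Fin d) ℚ) *ᵥ v
      invFun := fun v => ((A⁻¹ : GL (Fin d) ℚ) : Matrix (Fin d) (Fin d) ℚ) *ᵥ v
      left_inv := fun v => by
        change _ *ᵥ (_ *ᵥ v) = v
        rw [Matrix.mulVec_mulVec, ← Units.val_mul]; simp
      right_inv := fun v => by
        change _ *ᵥ (_ *ᵥ v) = v
        rw [Matrix.mulVec_mulVec, ← Units.val_mul]; simp
      map_add' := fun v w => Matrix.mulVec_add _ v w }

/-- The semidirect product `ℤ ⋉_A ℚ^d`, the generator of `ℤ` acting on `ℚ^d` by `A`. -/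
abbrev ZSemi {d : ℕ} (A : GL (Fin d) ℚ) : Type :=
  Multiplicative (Fin d → ℚ) ⋊[zpowersHom (MulAut (Multiplicative (Fin d → ℚ))) (glAut A)]
    Multiplicative ℤ

theorem glAut_zpow_mem {d : ℕ} (A : GL (Fin d) ℚ) (H : AddSubgroup (Fin d → ℚ))
    (hAH : ∀ v, (A : Matrix (Fin d) (Fin d) ℚ) *ᵥ v ∈ H ↔ v ∈ H) (n : ℤ)
    (v : Multiplicative (Fin d → ℚ)) :
    Multiplicative.toAdd ((glAut A ^ n) v) ∈ H ↔ Multiplicative.toAdd v ∈ H := by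
  have h1 : ∀ w : Multiplicative (Fin d → ℚ),
      Multiplicative.toAdd (glAut A w) ∈ H ↔ Multiplicative.toAdd w ∈ H := fun w => hAH _
  induction n generalizing v with
  | zero => simp
  | succ k ih =>
    rw [zpow_add_one]
    exact (ih (glAut A v)).trans (h1 v)
  | pred k ih =>
    rw [zpow_sub_one]
    refine (ih ((glAut A)⁻¹ v)).trans ((h1 _).symm.trans ?_)
    rw [MulAut.apply_inv_self]

/-- For a subgroup `H` of `ℚ^d` with `A H = H`, the subgroup `ℤ ⋉_A H` of `ℤ ⋉_A ℚ^d`. -/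
def ZSemiSub {d : ℕ} (A : GL (Fin d) ℚ) (H : AddSubgroup (Fin d → ℚ))
    (hAH : ∀ v, (A : Matrix (Fin d) (Fin d) ℚ) *ᵥ v ∈ H ↔ v ∈ H) : Subgroup (ZSemi A) where
  carrier := {g | Multiplicative.toAdd g.left ∈ H}
  one_mem' := H.zero_mem
  mul_mem' := by
    intro g h hg hh
    exact H.add_mem hg ((glAut_zpow_mem A H hAH _ _).2 hh)
  inv_mem' := by
    intro g hg
    exact (glAut_zpow_mem A H hAH _ _).2 (H.neg_mem hg)

/-- The generator `a` of the factor `ℤ` of `ℤ ⋉_A H`. -/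
noncomputable def genA {d : ℕ} (A : GL (Fin d) ℚ) (H : AddSubgroup (Fin d → ℚ))
    (hAH : ∀ v, (A : Matrix (Fin d) (Fin d) ℚ) *ᵥ v ∈ H ↔ v ∈ H) : ZSemiSub A H hAH :=
  ⟨SemidirectProduct.inr (Multiplicative.ofAdd 1), H.zero_mem⟩

/-- An element `b` of `H`, seen in `ℤ ⋉_A H`. -/
noncomputable def ofH {d : ℕ} (A : GL (Fin d) ℚ) (H : AddSubgroup (Fin d → ℚ))
    (hAH : ∀ v, (A : Matrix (Fin d) (Fin d) ℚ) *ᵥ v ∈ H ↔ v ∈ H) (b : H) :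
    ZSemiSub A H hAH :=
  ⟨SemidirectProduct.inl (Multiplicative.ofAdd (b : Fin d → ℚ)), b.2⟩

/-- The defining relation `a b a⁻¹ = A b`. -/
theorem genA_conj_ofH {d : ℕ} (A : GL (Fin d) ℚ) (H : AddSubgroup (Fin d → ℚ))
    (hAH : ∀ v, (A : Matrix (Fin d) (Fin d) ℚ) *ᵥ v ∈ H ↔ v ∈ H) (b : H) :
    genA A H hAH * ofH A H hAH b * (genA A H hAH)⁻¹ =
      ofH A H hAH ⟨(A : Matrix (Fin d) (Fin d) ℚ) *ᵥ (b : Fin d → ℚ), (hAH _).2 b.2⟩ := by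
  apply Subtype.ext
  change SemidirectProduct.inr _ * SemidirectProduct.inl _ * (SemidirectProduct.inr _)⁻¹ = _
  rw [← map_inv, ← SemidirectProduct.inl_aut]
  simp only [zpowersHom_apply, toAdd_ofAdd, zpow_one]
  rfl

/-! ### Topological conjugacy to an affine action, interior multipliers -/

/-- The homeomorphism `F : (0,1) → ℝ` conjugates the action `Φ` on `(0,1)` to the affine
action `ψ` on the line: `Φ(g) ∘ F⁻¹ = F⁻¹ ∘ ψ(g)` for all `g`. -/
def IsConjugacy {G : Type*} [Group G] (Φ : G →* DiffOnePlus) (ψ : G →* AffPlus)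
    (F : Ioo (0 : I) 1 ≃ₜ ℝ) : Prop :=
  ∀ (g : G) (t : ℝ), (Φ g : I ≃ₜ I) (F.symm t : I) = (F.symm ((ψ g : ℝ ≃ᵃ[ℝ] ℝ) t) : I)

/-- `f` has exactly one fixed point in `(0,1)`, and the derivative of `f` there is `r`. -/
def HasInteriorMultiplier (f : DiffOnePlus) (r : ℝ) : Prop :=
  ∃ x ∈ Ioo (0 : I) 1, (∀ y ∈ Ioo (0 : I) 1, (f : I ≃ₜ I) y = y ↔ y = x) ∧
    HasDerivAt (realExt (f : I ≃ₜ I)) r (x : ℝ)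

/-- `f` is a homothety of ratio `r`, about some centre `c`; translations, and in particular
the identity, are excluded. -/
def IsHomothetyOfRatio (f : AffPlus) (r : ℝ) : Prop :=
  0 < r ∧ r ≠ 1 ∧ ∃ c : ℝ, ∀ t : ℝ, (f : ℝ ≃ᵃ[ℝ] ℝ) t = c + r * (t - c)

/-! Write `α` for the action of `a` on `H`. Hyperbolicity of `A` enters only through
`SubexponentialTrivial`: an additive function on `H` that grows subexponentially under `α` in both
time directions is zero. In particular `α`-invariant additive functions vanish. Applied to the
logarithms of the derivatives at the end points, this makes `H` tangent to the identity at `0` and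
`1` (`C1Action.tangentAction`).

The core compares two growth rates along an orbit `aⁿ x → 0`. Displacements of elements of `H` at
`aⁿ x` are almost additive, because the derivatives at `0` are `1`, and their signs are those of `φ
∘ α⁻ⁿ`, where the additive function `φ` describes the order of the `H`-orbit of `x`. By compactness
they are asymptotically proportional to `φ ∘ α⁻ⁿ`, with a factor growing at the exponential rate
`log Da(0)` (`growth_displacement`). On the other hand `aⁿ` contracts the intervals `[yₙ, x]` at
that same rate, whatever the `yₙ` (`tendsto_log_length`). The two rates cancel, so nothing has to be
known about `Da(0)`, which may well be `1`; what survives is information on `φ ∘ α⁻ⁿ`.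

Three conclusions follow. If `H` has a common fixed point in the interior, displacements are trapped
between fixed points, and `φ` is subexponential in both directions, one for each end of the
interval. So `φ = 0`, whereas Hölder's theorem would give a nonzero `φ` if `H` moved a point; hence
`H` acts trivially and the action is Abelian (`apply_eq_of_fixed`). Otherwise Hölder's theorem gives
a monotone semiconjugacy `F` to an affine action with `φ ∘ α = r φ`, `r ≠ 1` (`exists_semiAffine`).
For `r > 1` the distance from `x` to its image under `α⁻ⁿ b` decays at the rate `-log r`
(`tendsto_log_displacement`). This forbids intervals on which `F` is constant, so `F` is a
conjugacy. Near a fixed point `p` of `a` the same distances decay at the rate `-log Da(p)`, so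
`Da(p) = r`. The case `r < 1` follows by passing to `a⁻¹`, and the other multipliers by putting `aᵏ
b` in place of `a`. -/

open Filter Topology Asymptotics

/-! ### Additive real functions on groups of finite rank; Hölder's theorem. -/

/-- Every element of `H` has a positive multiple in the subgroup generated by the family `B`. -/
def RationallySpans {H ι : Type*} [AddCommGroup H] [Fintype ι] (B : ι → H) : Prop :=
  ∀ b : H, ∃ q : ℕ, 0 < q ∧ ∃ p : ι → ℤ, q • b = ∑ i, p i • B i

/-- The constant is uniform in `φ`: the sum over `B` acts as a norm on additive functions, and
normalized families of them have pointwise limits along ultrafilters. -/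
theorem addMonoidHom_bound_of_rationallySpans {H ι : Type*} [AddCommGroup H] [Fintype ι]
    {B : ι → H} (hB : RationallySpans B) (b : H) :
    ∃ C : ℝ, 0 ≤ C ∧ ∀ φ : H →+ ℝ, |φ b| ≤ C * ∑ i, |φ (B i)| := by
  obtain ⟨q, hq, p, hp⟩ := hB b
  refine ⟨∑ i, |(p i : ℝ)|, by positivity, fun φ => ?_⟩
  have h1 : (q : ℝ) * φ b = ∑ i, (p i : ℝ) * φ (B i) := by
    have := congrArg φ hp
    simpa using this
  have hq1 : (1 : ℝ) ≤ q := by exact_mod_cast hq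
  calc |φ b| ≤ (q : ℝ) * |φ b| := le_mul_of_one_le_left (abs_nonneg _) hq1
    _ = |(q : ℝ) * φ b| := by rw [abs_mul, Nat.abs_cast]
    _ ≤ ∑ i, |(p i : ℝ)| * |φ (B i)| := by
        rw [h1]
        refine (Finset.abs_sum_le_sum_abs _ _).trans (le_of_eq ?_)
        simp only [abs_mul]
    _ ≤ ∑ i, |(p i : ℝ)| * ∑ j, |φ (B j)| := by
        gcongr with i
        exact Finset.single_le_sum (f := fun j => |φ (B j)|) (fun j _ => abs_nonneg _)
          (Finset.mem_univ i)
    _ = _ := by rw [Finset.sum_mul]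

theorem sum_abs_pos_of_rationallySpans {H ι : Type*} [AddCommGroup H] [Fintype ι]
    {B : ι → H} (hB : RationallySpans B) {φ : H →+ ℝ} (hφ : φ ≠ 0) :
    0 < ∑ i, |φ (B i)| := by
  by_contra hcon
  apply hφ
  ext b
  obtain ⟨C, hC, h⟩ := addMonoidHom_bound_of_rationallySpans hB b
  have h0 : ∑ i, |φ (B i)| = 0 := le_antisymm (not_lt.1 hcon) (by positivity)
  have := h φ
  rw [h0, mul_zero] at this
  simpa using this

/-- An additive function which is nonnegative where another one is positive is a multiple of
it. -/
theorem exists_eq_mul_of_pos_imp_nonneg {H : Type*} [AddCommGroup H] (V W : H →+ ℝ)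
    (hW : W ≠ 0) (h : ∀ b, 0 < W b → 0 ≤ V b) : ∃ s : ℝ, 0 ≤ s ∧ ∀ b, V b = s * W b := by
  obtain ⟨c, hc⟩ : ∃ c, 0 < W c := by
    by_contra! hcon
    apply hW
    ext b
    have h1 := hcon b
    have h2 := hcon (-b)
    simp only [map_neg, AddMonoidHom.zero_apply] at *
    linarith
  refine ⟨V c / W c, div_nonneg (h c hc) hc.le, ?_⟩
  have key : ∀ b, V b ≤ V c / W c * W b := by
    intro b
    -- `W` is positive at `r.num • c - r.den • b`, hence `V` is nonnegative there. The bound follows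
    -- on letting `r` decrease to `W b / W c`.
    have h1 : ∀ r : ℚ, W b / W c < r → V b ≤ V c * r := by
      intro r hr
      have hd : (0 : ℝ) < r.den := by exact_mod_cast r.den_pos
      have hrd : (r : ℝ) * r.den = r.num := by exact_mod_cast Rat.mul_den_eq_num r
      have h2 : 0 < W (r.num • c - r.den • b) := by
        simp only [map_sub, map_zsmul, map_nsmul, zsmul_eq_mul, nsmul_eq_mul]
        rw [div_lt_iff₀ hc] at hr
        rw [← hrd]
        nlinarith
      have h3 := h _ h2
      simp only [map_sub, map_zsmul, map_nsmul, zsmul_eq_mul, nsmul_eq_mul] at h3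
      rw [← hrd] at h3
      have : 0 ≤ (r.den : ℝ) * (V c * r - V b) := by linarith
      have := nonneg_of_mul_nonneg_right this hd
      linarith
    rcases (h c hc).eq_or_lt with h0 | h0
    · obtain ⟨r, hr⟩ := exists_rat_gt (W b / W c)
      have := h1 r hr
      rw [← h0] at this ⊢
      simpa using this
    · have h4 : V b / V c ≤ W b / W c := by
        refine le_of_forall_gt_imp_ge_of_dense fun t ht => ?_
        obtain ⟨r, hr1, hr2⟩ := exists_rat_btwn ht
        have := h1 r hr1
        rw [div_le_iff₀ h0]
        nlinarith
      rw [div_le_iff₀ h0] at h4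
      calc V b ≤ _ := h4
        _ = _ := by ring
  intro b
  refine le_antisymm (key b) ?_
  have := key (-b)
  simp only [map_neg] at this
  linarith

theorem Ultrafilter.exists_tendsto_of_abs_le (U : Ultrafilter ℕ) {u : ℕ → ℝ} {C : ℝ}
    (hu : ∀ᶠ n in (U : Filter ℕ), |u n| ≤ C) : ∃ t, Tendsto u U (𝓝 t) := by
  obtain ⟨t, -, ht⟩ := (isCompact_Icc (a := -C) (b := C)).ultrafilter_le_nhds (U.map u) (by
    rw [le_principal_iff]
    exact mem_of_superset (x := {n | |u n| ≤ C}) hu fun n hn => abs_le.1 hn)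
  exact ⟨t, ht⟩

/-- Hölder's theorem for a translation invariant total preorder on an abelian group of finite
rank: there is a nonzero monotone homomorphism to the reals. -/
theorem exists_monotone_addMonoidHom {H ι : Type*} [AddCommGroup H] [Fintype ι]
    {B : ι → H} (hB : RationallySpans B) (o : H → ℝ)
    (ho : ∀ b c d, o b ≤ o c → o (b + d) ≤ o (c + d)) (hne : ∃ b, o b ≠ o 0) :
    ∃ φ : H →+ ℝ, φ ≠ 0 ∧ ∀ b, o 0 ≤ o b → 0 ≤ φ b := by
  have ho' : ∀ b c d, o b ≤ o c ↔ o (b + d) ≤ o (c + d) := fun b c d =>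
    ⟨ho b c d, fun h => by simpa using ho _ _ (-d) h⟩
  have hadd : ∀ b c b' c', o b ≤ o c → o b' ≤ o c' → o (b + b') ≤ o (c + c') := by
    intro b c b' c' h1 h2
    refine (ho _ _ b' h1).trans ?_
    rw [add_comm c, add_comm c]
    exact ho _ _ c h2
  have hneg : ∀ b c, o b ≤ o c ↔ o (-c) ≤ o (-b) := by
    intro b c
    rw [ho' b c (-b - c)]
    congr! 2 <;> abel
  have hsmul : ∀ (n : ℕ) b c, o b ≤ o c → o (n • b) ≤ o (n • c) := by
    intro n b c h
    induction n with
    | zero => simp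
    | succ n ih => rw [succ_nsmul, succ_nsmul]; exact hadd _ _ _ _ ih h
  have hpos : ∀ (n : ℕ) b, o 0 ≤ o b → o 0 ≤ o (n • b) := by
    intro n b h
    simpa using hsmul n 0 b h
  have hsum : ∀ (s : Finset ι) (u v : ι → H), (∀ i ∈ s, o (u i) ≤ o (v i)) →
      o (∑ i ∈ s, u i) ≤ o (∑ i ∈ s, v i) := by
    classical
    intro s u v h
    induction s using Finset.induction_on with
    | empty => simp
    | insert i s hi ih =>
      rw [Finset.sum_insert hi, Finset.sum_insert hi]
      exact hadd _ _ _ _ (h i (by simp)) (ih fun j hj => h j (by simp [hj]))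
  -- `c i` is an absolute value of `B i` for the preorder. The sum `h` of these is cofinal, and it
  -- serves as the unit of measurement.
  have hge : ∀ i, ∃ c : H, o 0 ≤ o c ∧ o (B i) ≤ o c ∧ o (-B i) ≤ o c := by
    intro i
    rcases le_total (o 0) (o (B i)) with h | h
    · exact ⟨B i, h, le_rfl, ((hneg _ _).1 h).trans (by simpa using h)⟩
    · have h' := (hneg _ _).1 h
      simp only [neg_zero] at h'
      exact ⟨-B i, h', h.trans h', le_rfl⟩
  choose c hc0 hc1 hc2 using hge
  set h : H := ∑ i, c i with hh
  have hch : ∀ i, o (c i) ≤ o h := by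
    classical
    intro i
    have := hsum Finset.univ (fun j => if j = i then c i else 0) c (by
      intro j _
      by_cases hj : j = i
      · simp [hj]
      · simp [hj, hc0])
    simpa using this
  have h0h : o 0 ≤ o h := by
    have := hsum Finset.univ (fun _ => 0) c (fun i _ => hc0 i)
    simpa using this
  have hzs : ∀ (p : ℤ) i, o (p • B i) ≤ o (p.natAbs • h) := by
    intro p i
    rcases Int.natAbs_eq p with hp | hp
    · conv_lhs => rw [hp, natCast_zsmul]
      exact hsmul _ _ _ ((hc1 i).trans (hch i))
    · conv_lhs => rw [hp, neg_smul, natCast_zsmul, ← smul_neg]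
      exact hsmul _ _ _ ((hc2 i).trans (hch i))
  have hcof : ∀ b, ∃ k : ℕ, o b ≤ o (k • h) := by
    intro b
    rcases le_total (o b) (o 0) with hb | hb
    · exact ⟨0, by simpa using hb⟩
    · obtain ⟨q, hq, p, hp⟩ := hB b
      refine ⟨∑ i, (p i).natAbs, ?_⟩
      have h1 : o b ≤ o (q • b) := by
        obtain ⟨m, rfl⟩ : ∃ m, q = m + 1 := ⟨q - 1, by omega⟩
        rw [succ_nsmul]
        simpa using hadd 0 (m • b) b b (hpos m b hb) le_rfl
      refine h1.trans ?_
      rw [hp, Finset.sum_smul]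
      exact hsum _ _ _ fun i _ => hzs _ _
  -- If `h` were equivalent to `0`, cofinality would make the whole preorder trivial, against `hne`.
  have hlt : o 0 < o h := by
    refine lt_of_le_of_ne h0h fun heq => ?_
    obtain ⟨b, hb⟩ := hne
    apply hb
    have h1 : ∀ b, o b ≤ o 0 := by
      intro b
      obtain ⟨k, hk⟩ := hcof b
      refine hk.trans ?_
      simpa using hsmul k h 0 heq.symm.le
    refine le_antisymm (h1 b) ?_
    have := (hneg _ _).1 (h1 (-b))
    simpa using this
  have hmono : ∀ k l : ℤ, o (k • h) ≤ o (l • h) ↔ k ≤ l := by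
    have h1 : ∀ k l : ℤ, k ≤ l → o (k • h) ≤ o (l • h) := by
      intro k l hkl
      obtain ⟨n, rfl⟩ := Int.le.dest hkl
      have := hadd (k • h) (k • h) 0 (n • h) le_rfl (hpos n h h0h)
      rwa [add_zero, ← natCast_zsmul, ← add_smul] at this
    intro k l
    refine ⟨fun hkl => ?_, h1 k l⟩
    by_contra! hcon
    have h2 := (h1 (l + 1) k (by omega)).trans hkl
    rw [add_smul, one_smul] at h2
    have h3 : o (0 + l • h) < o (h + l • h) := by
      refine lt_of_not_ge fun h4 => ?_
      exact absurd ((ho' h 0 (l • h)).2 h4) (not_le.2 hlt)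
    rw [zero_add, add_comm h] at h3
    exact absurd h2 (not_le.2 h3)
  -- `fl b` is the integer part of `b` measured by `h`. It is additive up to an error of at most
  -- `2`, which disappears in the homogenization `fl (n • b) / n`.
  have hfl : ∀ b, ∃ k : ℤ, o (k • h) ≤ o b ∧ ∀ l : ℤ, o (l • h) ≤ o b → l ≤ k := by
    intro b
    apply Int.exists_greatest_of_bdd
    · obtain ⟨K, hK⟩ := hcof b
      refine ⟨K, fun z hz => ?_⟩
      rw [← hmono]
      exact hz.trans (by simpa using hK)
    · obtain ⟨K, hK⟩ := hcof (-b)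
      refine ⟨-K, ?_⟩
      have := (hneg _ _).1 hK
      simpa using this
  choose fl hfl1 hfl2 using hfl
  have hfl3 : ∀ b, o b ≤ o ((fl b + 1) • h) := by
    intro b
    by_contra! hcon
    have := hfl2 b _ hcon.le
    omega
  have hq1 : ∀ b c, fl b + fl c ≤ fl (b + c) := by
    intro b c
    apply hfl2
    rw [add_smul]
    exact hadd _ _ _ _ (hfl1 b) (hfl1 c)
  have hq2 : ∀ b c, fl (b + c) ≤ fl b + fl c + 2 := by
    intro b c
    rw [← hmono]
    refine (hfl1 _).trans ((hadd _ _ _ _ (hfl3 b) (hfl3 c)).trans (le_of_eq ?_))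
    rw [← add_smul]; congr 2; ring
  have hbd : ∀ b, ∃ K : ℕ, ∀ n : ℕ, |(fl (n • b) : ℝ) / n| ≤ K := by
    intro b
    obtain ⟨K1, hK1⟩ := hcof b
    obtain ⟨K2, hK2⟩ := hcof (-b)
    refine ⟨K1 + K2, fun n => ?_⟩
    have h1 : fl (n • b) ≤ n * K1 := by
      rw [← hmono]
      refine (hfl1 _).trans ((hsmul n _ _ hK1).trans (le_of_eq ?_))
      rw [mul_smul, natCast_zsmul, natCast_zsmul]
    have h2 : -(n * K2 : ℤ) ≤ fl (n • b) := by
      apply hfl2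
      rw [hneg, ← neg_smul, neg_neg, ← smul_neg]
      refine (hsmul n _ _ hK2).trans (le_of_eq ?_)
      rw [mul_smul, natCast_zsmul, natCast_zsmul]
    have h1' : (fl (n • b) : ℝ) ≤ n * K1 := by exact_mod_cast h1
    have h2' : -(n * K2 : ℝ) ≤ fl (n • b) := by exact_mod_cast h2
    rw [abs_div, Nat.abs_cast]
    rcases Nat.eq_zero_or_pos n with rfl | hn
    · simp; positivity
    · have hn' : (0 : ℝ) < n := by exact_mod_cast hn
      rw [div_le_iff₀ hn', abs_le]
      push_cast
      constructor <;> nlinarith [mul_nonneg hn'.le (Nat.cast_nonneg (α := ℝ) K1),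
        mul_nonneg hn'.le (Nat.cast_nonneg (α := ℝ) K2)]
  -- A limit along a fixed ultrafilter, the same for all `b`, suffices; ordinary convergence is not
  -- needed for additivity.
  have hlim : ∀ b, ∃ t : ℝ, Tendsto (fun n : ℕ => (fl (n • b) : ℝ) / n)
      (hyperfilter ℕ : Filter ℕ) (𝓝 t) := by
    intro b
    obtain ⟨K, hK⟩ := hbd b
    exact Ultrafilter.exists_tendsto_of_abs_le _ (Eventually.of_forall hK)
  choose τ hτ using hlim
  have hinv : Tendsto (fun n : ℕ => (2 : ℝ) / n) (hyperfilter ℕ : Filter ℕ) (𝓝 0) :=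
    (tendsto_const_div_atTop_nhds_zero_nat 2).mono_left
      (Nat.hyperfilter_le_atTop)
  have hτadd : ∀ b c, τ (b + c) = τ b + τ c := by
    intro b c
    refine tendsto_nhds_unique_of_eventuallyEq (f := fun n : ℕ => (fl (n • (b + c)) : ℝ) / n)
      (g := fun n : ℕ => (fl (n • (b + c)) : ℝ) / n) (hτ _) ?_ (by rfl)
    have h1 := (hτ b).add (hτ c)
    have h2 := h1.add hinv
    rw [add_zero] at h2
    refine tendsto_of_tendsto_of_tendsto_of_le_of_le h1 h2 (fun n => ?_) (fun n => ?_)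
    · have : (fl (n • b) : ℝ) + fl (n • c) ≤ fl (n • (b + c)) := by
        rw [smul_add]; exact_mod_cast hq1 _ _
      rw [← add_div]
      gcongr
    · have : (fl (n • (b + c)) : ℝ) ≤ fl (n • b) + fl (n • c) + 2 := by
        rw [smul_add]; exact_mod_cast hq2 _ _
      rw [← add_div, ← add_div]
      gcongr
  refine ⟨AddMonoidHom.mk' τ hτadd, fun h0 => ?_, ?_⟩
  · have h0' : τ h = 0 := DFunLike.congr_fun h0 h
    refine one_ne_zero (h0'.symm.trans (tendsto_nhds_unique (hτ h) ?_)).symm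
    refine tendsto_const_nhds.congr' ?_
    have : ∀ᶠ n : ℕ in (hyperfilter ℕ : Filter ℕ), 1 ≤ n :=
      (eventually_ge_atTop 1).filter_mono Nat.hyperfilter_le_atTop
    filter_upwards [this] with n hn
    have h1 : fl (n • h) = n := by
      refine le_antisymm ?_ ?_
      · rw [← hmono]; simpa using hfl1 (n • h)
      · apply hfl2; simp
    rw [h1]
    have : (n : ℝ) ≠ 0 := by positivity
    simp [this]
  · intro b hb
    refine ge_of_tendsto' (hτ b) fun n => ?_
    have : 0 ≤ fl (n • b) := by
      apply hfl2; simpa using hpos n b hb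
    have : (0 : ℝ) ≤ fl (n • b) := by exact_mod_cast this
    positivity

/-! ### Asymptotics of almost additive displacements. -/

/-- A positive sequence with ratios converging to `ρ` has logarithmic growth rate `log ρ`. -/
theorem tendsto_log_div_of_ratio {u : ℕ → ℝ} (hu : ∀ n, 0 < u n) {ρ : ℝ} (hρ : 0 < ρ)
    (h : Tendsto (fun n => u (n + 1) / u n) atTop (𝓝 ρ)) :
    Tendsto (fun n : ℕ => Real.log (u n) / n) atTop (𝓝 (Real.log ρ)) := by
  have h1 : Tendsto (fun n => Real.log (u (n + 1)) - Real.log (u n)) atTop (𝓝 (Real.log ρ)) := by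
    refine ((Real.continuousAt_log hρ.ne').tendsto.comp h).congr fun n => ?_
    simp [Real.log_div (hu _).ne' (hu _).ne']
  have h2 := h1.cesaro
  have h3 : Tendsto (fun n : ℕ => Real.log (u 0) / n) atTop (𝓝 0) :=
    tendsto_const_div_atTop_nhds_zero_nat _
  have h4 := h2.add h3
  rw [add_zero] at h4
  refine h4.congr fun n => ?_
  rw [Finset.sum_range_sub (fun n => Real.log (u n))]
  ring

section Displacement

variable {H ι : Type*} [AddCommGroup H] [Fintype ι] {B : ι → H} {d : H → ℕ → ℝ} {l : Filter ℕ}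

/-- The elements with displacement controlled by the generators form a subgroup. Some multiple `q •
b` lies in it, and almost additivity gives `d (q • b) = q d b + o(d b)`, so `d b` itself is
controlled. -/
theorem isBigO_sum_abs_of_almost_additive (hB : RationallySpans B)
    (hd0 : ∀ n, d 0 n = 0)
    (hadd : ∀ b c, (fun n => d (b + c) n - d b n - d c n) =o[l] d c) (b : H) :
    d b =O[l] fun n => ∑ i, |d (B i) n| := by
  set N : ℕ → ℝ := fun n => ∑ i, |d (B i) n| with hN
  have hplus : ∀ b c, d b =O[l] N → d c =O[l] N → d (b + c) =O[l] N := by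
    intro b c hb hc
    have := ((hadd b c).isBigO.trans hc).add (hb.add hc)
    refine this.congr_left fun n => ?_
    ring
  have hneg : ∀ b, d b =O[l] N → d (-b) =O[l] N := by
    intro b hb
    have h1 := (hadd (-b) b).isBigO.trans hb
    refine (h1.add hb).neg_left.congr_left fun n => ?_
    simp [hd0]
  have h0 : d 0 =O[l] N := (isBigO_zero N l).congr_left fun n => (hd0 n).symm
  let S : AddSubgroup H :=
    { carrier := {b | d b =O[l] N}
      zero_mem' := h0
      add_mem' := fun hb hc => hplus _ _ hb hc
      neg_mem' := fun hb => hneg _ hb }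
  have hBS : ∀ i, B i ∈ S := by
    intro i
    refine IsBigO.of_bound 1 (Eventually.of_forall fun n => ?_)
    rw [one_mul, Real.norm_eq_abs, Real.norm_of_nonneg (by positivity)]
    exact Finset.single_le_sum (f := fun j => |d (B j) n|) (fun j _ => abs_nonneg _)
      (Finset.mem_univ i)
  obtain ⟨q, hq, p, hp⟩ := hB b
  have hqS : d (q • b) =O[l] N := by
    have : q • b ∈ S := by
      rw [hp]
      exact S.sum_mem fun i _ => S.zsmul_mem (hBS i) _
    exact this
  have hqo : ∀ m : ℕ, (fun n => d (m • b) n - m * d b n) =o[l] d b := by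
    intro m
    induction m with
    | zero => simp [hd0]
    | succ m ih =>
      refine ((hadd (m • b) b).add ih).congr_left fun n => ?_
      rw [succ_nsmul]
      push_cast
      ring
  have hq' : (q : ℝ) ≠ 0 := by positivity
  have h1 : (fun n => (q : ℝ) * d b n) =O[l] d (q • b) := by
    have h2 : (fun n => d (q • b) n - q * d b n) =o[l] fun n => (q : ℝ) * d b n :=
      (hqo q).trans_isBigO (isBigO_self_const_mul hq' _ _)
    simpa using h2.right_isBigO_add
  exact ((isBigO_self_const_mul hq' _ _).trans h1).trans hqS

theorem sum_abs_pos_of_sign (hB : RationallySpans B) {φ : H →+ ℝ} (hφ : φ ≠ 0) {e : H → ℝ}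
    (hpos : ∀ b, 0 < φ b → 0 < e b) (hneg : ∀ b, φ b < 0 → e b < 0) : 0 < ∑ i, |e (B i)| := by
  obtain ⟨i, -, hi⟩ := Finset.exists_ne_zero_of_sum_ne_zero
    (sum_abs_pos_of_rationallySpans hB hφ).ne'
  refine Finset.sum_pos' (fun i _ => abs_nonneg _) ⟨i, Finset.mem_univ i, ?_⟩
  rcases lt_or_gt_of_ne (abs_ne_zero.1 hi) with h | h
  · exact abs_pos.2 (hneg _ h).ne
  · exact abs_pos.2 (hpos _ h).ne'

/-- Almost additive displacements whose signs are given by additive functions are asymptotically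
proportional to these functions. -/
theorem tendsto_displacement_sub_addMonoidHom (hB : RationallySpans B)
    (hd0 : ∀ n, d 0 n = 0)
    (hadd : ∀ b c, (fun n => d (b + c) n - d b n - d c n) =o[atTop] d c)
    {φ : ℕ → H →+ ℝ} (hφ : ∀ n, φ n ≠ 0)
    (hpos : ∀ n b, 0 < φ n b → 0 < d b n) (hneg : ∀ n b, φ n b < 0 → d b n < 0) (b : H) :
    Tendsto (fun n => d b n / (∑ i, |d (B i) n|) - φ n b / ∑ i, |φ n (B i)|) atTop (𝓝 0) := by
  have hN : ∀ n, 0 < ∑ i, |d (B i) n| := fun n =>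
    sum_abs_pos_of_sign hB (hφ n) (e := fun b => d b n) (hpos n) (hneg n)
  have hS : ∀ n, 0 < ∑ i, |φ n (B i)| := fun n => sum_abs_pos_of_rationallySpans hB (hφ n)
  set N : ℕ → ℝ := fun n => ∑ i, |d (B i) n| with hNdef
  set S : ℕ → ℝ := fun n => ∑ i, |φ n (B i)| with hSdef
  replace hN : ∀ n, 0 < N n := hN
  replace hS : ∀ n, 0 < S n := hS
  have hO := isBigO_sum_abs_of_almost_additive hB hd0 hadd
  -- Along an ultrafilter both normalized families converge, to additive functions `V` and `W`. The
  -- signs make `V` a nonnegative multiple of `W`, and the normalization of the sums over `B` to `1`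
  -- makes the factor `1`.
  rw [tendsto_iff_ultrafilter]
  intro U hU
  have hV : ∀ b, ∃ t, Tendsto (fun n => d b n / N n) U (𝓝 t) := by
    intro b
    obtain ⟨C, hC⟩ := (hO b).bound
    refine U.exists_tendsto_of_abs_le (C := C) ((hC.filter_mono hU).mono fun n hn => ?_)
    rw [abs_div, abs_of_pos (hN n), div_le_iff₀ (hN n)]
    have hn' : ‖d b n‖ ≤ C * ‖N n‖ := hn
    rwa [Real.norm_eq_abs, Real.norm_of_nonneg (hN n).le] at hn'
  have hW : ∀ b, ∃ t, Tendsto (fun n => φ n b / S n) U (𝓝 t) := by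
    intro b
    obtain ⟨C, -, hC⟩ := addMonoidHom_bound_of_rationallySpans hB b
    refine U.exists_tendsto_of_abs_le (C := C) (Eventually.of_forall fun n => ?_)
    rw [abs_div, abs_of_pos (hS n), div_le_iff₀ (hS n)]
    exact hC (φ n)
  choose V hV using hV
  choose W hW using hW
  have hVadd : ∀ b c, V (b + c) = V b + V c := by
    intro b c
    refine tendsto_nhds_unique (hV (b + c)) ?_
    have h1 : Tendsto (fun n => (d (b + c) n - d b n - d c n) / N n) U (𝓝 0) :=
      (((hadd b c).trans_isBigO (hO c)).tendsto_div_nhds_zero).mono_left hU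
    have h2 := (h1.add (hV b)).add (hV c)
    rw [zero_add] at h2
    refine h2.congr fun n => ?_
    ring
  have hWadd : ∀ b c, W (b + c) = W b + W c := by
    intro b c
    refine tendsto_nhds_unique (hW (b + c)) ?_
    refine ((hW b).add (hW c)).congr fun n => ?_
    rw [map_add]; ring
  have hVsum : ∑ i, |V (B i)| = 1 := by
    refine tendsto_nhds_unique (tendsto_finsetSum _ fun i _ => (hV (B i)).abs) ?_
    refine tendsto_const_nhds.congr fun n => ?_
    simp only [abs_div, abs_of_pos (hN n)]
    rw [← Finset.sum_div, div_self (hN n).ne']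
  have hWsum : ∑ i, |W (B i)| = 1 := by
    refine tendsto_nhds_unique (tendsto_finsetSum _ fun i _ => (hW (B i)).abs) ?_
    refine tendsto_const_nhds.congr fun n => ?_
    simp only [abs_div, abs_of_pos (hS n)]
    rw [← Finset.sum_div, div_self (hS n).ne']
  obtain ⟨s, hs0, hs⟩ := exists_eq_mul_of_pos_imp_nonneg (AddMonoidHom.mk' V hVadd)
    (AddMonoidHom.mk' W hWadd) (by
      intro h0
      have : ∀ b, W b = 0 := fun b => DFunLike.congr_fun h0 b
      simp [this] at hWsum) (by
      intro b hb
      have hb : 0 < W b := hb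
      refine ge_of_tendsto (hV b) ?_
      filter_upwards [(hW b).eventually (lt_mem_nhds hb)] with n hn
      have : 0 < φ n b := by
        rw [lt_div_iff₀ (hS n), zero_mul] at hn
        exact hn
      exact (div_pos (hpos n b this) (hN n)).le)
  have hs : ∀ b, V b = s * W b := hs
  have hs1 : s = 1 := by
    rw [← hVsum]
    simp only [hs, abs_mul, ← Finset.mul_sum, hWsum, mul_one]
    rw [abs_of_nonneg hs0]
  have := (hV b).sub (hW b)
  rw [hs b, hs1, one_mul, sub_self] at this
  exact this

/-- The ratio between the size of the displacements along an orbit and the size of the governing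
additive functions grows at the rate given by the derivative `ν`. -/
theorem tendsto_ratio_displacement (hB : RationallySpans B)
    (hd0 : ∀ n, d 0 n = 0)
    (hadd : ∀ b c, (fun n => d (b + c) n - d b n - d c n) =o[atTop] d c)
    {φ : ℕ → H →+ ℝ} (hφ : ∀ n, φ n ≠ 0)
    (hpos : ∀ n b, 0 < φ n b → 0 < d b n) (hneg : ∀ n b, φ n b < 0 → d b n < 0)
    (α : H ≃+ H) (hα : ∀ n b, φ (n + 1) (α b) = φ n b) {ν : ℝ}
    (hν : ∀ b, (fun n => d (α b) (n + 1) - ν * d b n) =o[atTop] d b) :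
    Tendsto (fun n => ((∑ i, |d (B i) (n + 1)|) / ∑ i, |φ (n + 1) (B i)|) /
      ((∑ i, |d (B i) n|) / ∑ i, |φ n (B i)|)) atTop (𝓝 |ν|) := by
  have hN : ∀ n, 0 < ∑ i, |d (B i) n| := fun n =>
    sum_abs_pos_of_sign hB (hφ n) (e := fun b => d b n) (hpos n) (hneg n)
  have hS : ∀ n, 0 < ∑ i, |φ n (B i)| := fun n => sum_abs_pos_of_rationallySpans hB (hφ n)
  have hlim := tendsto_displacement_sub_addMonoidHom hB hd0 hadd hφ hpos hneg
  have hO := isBigO_sum_abs_of_almost_additive hB hd0 hadd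
  set N : ℕ → ℝ := fun n => ∑ i, |d (B i) n| with hNdef
  set S : ℕ → ℝ := fun n => ∑ i, |φ n (B i)| with hSdef
  replace hN : ∀ n, 0 < N n := hN
  replace hS : ∀ n, 0 < S n := hS
  -- Both asymptotics are applied to `α⁻¹ b`: its displacement at time `n` is multiplied by `ν` to
  -- give that of `b` at time `n + 1`, and `φ n (α⁻¹ b) = φ (n + 1) b`.
  have h1 : ∀ b, Tendsto (fun n => d b (n + 1) / N n - ν * (φ (n + 1) b / S n)) atTop
      (𝓝 0) := by
    intro b
    have h2 := ((hν (α.symm b)).trans_isBigO (hO _)).tendsto_div_nhds_zero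
    have h3 := h2.add ((hlim (α.symm b)).const_mul ν)
    rw [mul_zero, add_zero] at h3
    refine h3.congr fun n => ?_
    have h4 := hα n (α.symm b)
    simp only [AddEquiv.apply_symm_apply] at h4 ⊢
    rw [h4]
    ring
  have h2 : Tendsto (fun n => N (n + 1) / N n - |ν| * (S (n + 1) / S n)) atTop (𝓝 0) := by
    have h3 : Tendsto (fun n => ∑ i, |d (B i) (n + 1) / N n - ν * (φ (n + 1) (B i) / S n)|)
        atTop (𝓝 0) := by
      have := tendsto_finsetSum Finset.univ fun i _ => (h1 (B i)).abs
      simpa using this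
    refine squeeze_zero_norm (fun n => ?_) h3
    have e1 : N (n + 1) / N n = ∑ i, |d (B i) (n + 1) / N n| := by
      simp only [abs_div, abs_of_pos (hN n)]
      rw [← Finset.sum_div]
    have e2 : |ν| * (S (n + 1) / S n) = ∑ i, |ν * (φ (n + 1) (B i) / S n)| := by
      simp only [abs_mul, abs_div, abs_of_pos (hS n)]
      rw [← Finset.mul_sum, ← Finset.sum_div]
    rw [e1, e2, ← Finset.sum_sub_distrib, Real.norm_eq_abs]
    refine (Finset.abs_sum_le_sum_abs _ _).trans (Finset.sum_le_sum fun i _ => ?_)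
    exact abs_abs_sub_abs_le_abs_sub _ _
  -- `S n` is the sum of the `|φ (n + 1) (α (B i))|`, which the uniform bound compares with `S (n +
  -- 1)`.
  have h3 : ∃ C, ∀ n, |S n / S (n + 1)| ≤ C := by
    choose C hC0 hC using fun i => addMonoidHom_bound_of_rationallySpans hB (α (B i))
    refine ⟨∑ i, C i, fun n => ?_⟩
    rw [abs_of_pos (div_pos (hS _) (hS _)), div_le_iff₀ (hS _), Finset.sum_mul]
    refine Finset.sum_le_sum fun i _ => ?_
    rw [← hα]
    exact hC i _
  obtain ⟨C, hC⟩ := h3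
  have h4 : Tendsto (fun n => (N (n + 1) / N n - |ν| * (S (n + 1) / S n)) * (S n / S (n + 1)))
      atTop (𝓝 0) := by
    refine h2.zero_mul_isBoundedUnder_le ?_
    exact ⟨C, eventually_map.2 (Eventually.of_forall hC)⟩
  have h5 := h4.add_const |ν|
  rw [zero_add] at h5
  refine h5.congr fun n => ?_
  have a1 := (hN n).ne'
  have a2 := (hN (n + 1)).ne'
  have a3 := (hS n).ne'
  have a4 := (hS (n + 1)).ne'
  change (N (n + 1) / N n - |ν| * (S (n + 1) / S n)) * (S n / S (n + 1)) + |ν| =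
    N (n + 1) / S (n + 1) / (N n / S n)
  field_simp
  ring

end Displacement

/-! ### `C¹` actions on the interval and distortion near an end point. -/

/-- An action of a group on `[0,1]` by increasing `C¹` maps, each given as a real function whose
values outside of `[0,1]` are irrelevant. -/
structure C1Action {Γ : Type*} [Group Γ] (E : Γ → ℝ → ℝ) : Prop where
  one : ∀ x ∈ Icc (0 : ℝ) 1, E 1 x = x
  mul : ∀ g h, ∀ x ∈ Icc (0 : ℝ) 1, E (g * h) x = E g (E h x)
  mapsTo : ∀ g, MapsTo (E g) (Icc 0 1) (Icc 0 1)
  mono : ∀ g, StrictMonoOn (E g) (Icc 0 1)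
  contDiff : ∀ g, ContDiffOn ℝ 1 (E g) (Icc 0 1)

namespace C1Action

variable {Γ : Type*} [Group Γ] {E : Γ → ℝ → ℝ}

theorem inv_apply (hE : C1Action E) (g : Γ) {x : ℝ} (hx : x ∈ Icc (0 : ℝ) 1) :
    E g⁻¹ (E g x) = x := by
  rw [← hE.mul _ _ x hx, inv_mul_cancel, hE.one x hx]

theorem apply_inv (hE : C1Action E) (g : Γ) {x : ℝ} (hx : x ∈ Icc (0 : ℝ) 1) :
    E g (E g⁻¹ x) = x := by
  rw [← hE.mul _ _ x hx, mul_inv_cancel, hE.one x hx]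

theorem zero (hE : C1Action E) (g : Γ) : E g 0 = 0 := by
  have h0 : (0 : ℝ) ∈ Icc (0 : ℝ) 1 := by simp
  refine le_antisymm ?_ (hE.mapsTo g h0).1
  have h1 := (hE.mono g).monotoneOn h0 (hE.mapsTo g⁻¹ h0) (hE.mapsTo g⁻¹ h0).1
  rwa [hE.apply_inv g h0] at h1

theorem one_eq (hE : C1Action E) (g : Γ) : E g 1 = 1 := by
  have h0 : (1 : ℝ) ∈ Icc (0 : ℝ) 1 := by simp
  refine le_antisymm (hE.mapsTo g h0).2 ?_
  have h1 := (hE.mono g).monotoneOn (hE.mapsTo g⁻¹ h0) h0 (hE.mapsTo g⁻¹ h0).2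
  rwa [hE.apply_inv g h0] at h1

theorem mapsTo_Ioo (hE : C1Action E) (g : Γ) {x : ℝ} (hx : x ∈ Ioo (0 : ℝ) 1) :
    E g x ∈ Ioo (0 : ℝ) 1 := by
  have hx' := Ioo_subset_Icc_self hx
  constructor
  · have := hE.mono g (by simp) hx' hx.1
    rwa [hE.zero g] at this
  · have := hE.mono g hx' (by simp) hx.2
    rwa [hE.one_eq g] at this

theorem lt_iff (hE : C1Action E) (g : Γ) {x y : ℝ} (hx : x ∈ Icc (0 : ℝ) 1)
    (hy : y ∈ Icc (0 : ℝ) 1) : E g x < E g y ↔ x < y :=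
  (hE.mono g).lt_iff_lt hx hy

theorem le_iff (hE : C1Action E) (g : Γ) {x y : ℝ} (hx : x ∈ Icc (0 : ℝ) 1)
    (hy : y ∈ Icc (0 : ℝ) 1) : E g x ≤ E g y ↔ x ≤ y :=
  (hE.mono g).le_iff_le hx hy

/-- The action read from the other end of the interval. -/
theorem reverse (hE : C1Action E) : C1Action fun g x => 1 - E g (1 - x) where
  one x hx := by
    rw [hE.one _ (by constructor <;> linarith [hx.1, hx.2])]; ring
  mul g h x hx := by
    rw [hE.mul g h _ (by constructor <;> linarith [hx.1, hx.2])]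
    simp
  mapsTo g x hx := by
    have := hE.mapsTo g (x := 1 - x) (by constructor <;> linarith [hx.1, hx.2])
    constructor <;> linarith [this.1, this.2]
  mono g x hx y hy hxy := by
    have := hE.mono g (a := 1 - y) (b := 1 - x) (by constructor <;> linarith [hy.1, hy.2])
      (by constructor <;> linarith [hx.1, hx.2]) (by linarith)
    simp only
    linarith
  contDiff g := by
    refine contDiffOn_const.sub ((hE.contDiff g).comp (contDiffOn_const.sub contDiffOn_id) ?_)
    intro x hx
    constructor <;> simp <;> linarith [hx.1, hx.2]

/-- The derivative of an element of the action, one-sided at the end points. -/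
theorem hasDerivWithinAt (hE : C1Action E) (g : Γ) {x : ℝ} (hx : x ∈ Icc (0 : ℝ) 1) :
    HasDerivWithinAt (E g) (derivWithin (E g) (Icc 0 1) x) (Icc 0 1) x :=
  ((hE.contDiff g).differentiableOn one_ne_zero x hx).hasDerivWithinAt

theorem continuousOn_deriv (hE : C1Action E) (g : Γ) :
    ContinuousOn (derivWithin (E g) (Icc 0 1)) (Icc (0 : ℝ) 1) :=
  (hE.contDiff g).continuousOn_derivWithin (uniqueDiffOn_Icc zero_lt_one) le_rfl

theorem deriv_mul (hE : C1Action E) (g h : Γ) {x : ℝ} (hx : x ∈ Icc (0 : ℝ) 1) :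
    derivWithin (E (g * h)) (Icc 0 1) x =
      derivWithin (E g) (Icc 0 1) (E h x) * derivWithin (E h) (Icc 0 1) x := by
  have h1 := (hE.hasDerivWithinAt g (hE.mapsTo h hx)).comp x (hE.hasDerivWithinAt h hx)
    (hE.mapsTo h)
  have h2 : HasDerivWithinAt (E (g * h)) _ (Icc 0 1) x :=
    h1.congr (fun y hy => hE.mul g h y hy) (hE.mul g h x hx)
  exact h2.derivWithin (uniqueDiffOn_Icc zero_lt_one x hx)

theorem deriv_one (hE : C1Action E) {x : ℝ} (hx : x ∈ Icc (0 : ℝ) 1) :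
    derivWithin (E 1) (Icc 0 1) x = 1 := by
  have h2 : HasDerivWithinAt (E 1) 1 (Icc 0 1) x :=
    (hasDerivWithinAt_id x _).congr (fun y hy => hE.one y hy) (hE.one x hx)
  exact h2.derivWithin (uniqueDiffOn_Icc zero_lt_one x hx)

theorem deriv_pos (hE : C1Action E) (g : Γ) {x : ℝ} (hx : x ∈ Icc (0 : ℝ) 1) :
    0 < derivWithin (E g) (Icc 0 1) x := by
  have h0 : 0 ≤ derivWithin (E g) (Icc 0 1) x := (hE.mono g).monotoneOn.derivWithin_nonneg
  refine lt_of_le_of_ne h0 fun h => ?_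
  have h1 := hE.deriv_mul g⁻¹ g hx
  rw [← h, mul_zero, inv_mul_cancel, hE.deriv_one hx] at h1
  exact one_ne_zero h1

theorem hasDerivAt (hE : C1Action E) (g : Γ) {x : ℝ} (hx : x ∈ Ioo (0 : ℝ) 1) :
    HasDerivAt (E g) (derivWithin (E g) (Icc 0 1) x) x :=
  (hE.hasDerivWithinAt g (Ioo_subset_Icc_self hx)).hasDerivAt (Icc_mem_nhds hx.1 hx.2)

/-- The derivative at the end point `0` is strict. -/
theorem isLittleO_sub (hE : C1Action E) (g : Γ) {u v : ℕ → ℝ}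
    (hu : ∀ n, u n ∈ Icc (0 : ℝ) 1) (hv : ∀ n, v n ∈ Icc (0 : ℝ) 1)
    (hu0 : Tendsto u atTop (𝓝 0)) (hv0 : Tendsto v atTop (𝓝 0)) :
    (fun n => E g (u n) - E g (v n) - derivWithin (E g) (Icc 0 1) 0 * (u n - v n))
      =o[atTop] fun n => u n - v n := by
  set m := derivWithin (E g) (Icc 0 1) 0 with hm
  rw [isLittleO_iff]
  intro ε hε
  have h0 : (0 : ℝ) ∈ Icc (0 : ℝ) 1 := by simp
  obtain ⟨δ, hδ, hδ'⟩ := Metric.continuousWithinAt_iff.1 (hE.continuousOn_deriv g 0 h0) ε hε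
  -- The mean value inequality for `E g x - m x`, whose derivative is small near `0` by continuity,
  -- gives the strict form of differentiability.
  have hs : Convex ℝ (Icc (0 : ℝ) 1 ∩ Metric.ball 0 δ) :=
    (convex_Icc _ _).inter (convex_ball _ _)
  filter_upwards [hu0.eventually (Metric.ball_mem_nhds 0 hδ),
    hv0.eventually (Metric.ball_mem_nhds 0 hδ)] with n hun hvn
  have h1 := hs.norm_image_sub_le_of_norm_hasDerivWithin_le (f := fun x => E g x - m * x)
    (f' := fun x => derivWithin (E g) (Icc 0 1) x - m) (C := ε) (x := v n) (y := u n)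
    (fun x hx => by
      have := (hE.hasDerivWithinAt g hx.1).sub ((hasDerivWithinAt_id x (Icc 0 1)).const_mul m)
      rw [mul_one] at this
      exact this.mono inter_subset_left)
    (fun x hx => (hδ' hx.1 hx.2).le) ⟨hv n, hvn⟩ ⟨hu n, hun⟩
  refine le_trans (le_of_eq ?_) h1
  congr 1
  ring

/-- Along orbits converging to `0`, lengths of intervals with moving end point contract at the
rate given by the derivative at `0`. -/
theorem tendsto_log_length (hE : C1Action E) (a : Γ) {x : ℝ} (hx : x ∈ Icc (0 : ℝ) 1)
    (hx0 : Tendsto (fun n : ℕ => E (a ^ n) x) atTop (𝓝 0)) {y : ℕ → ℝ}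
    (hy0 : ∀ n, 0 ≤ y n) (hyx : ∀ n, y n < x) :
    Tendsto (fun n : ℕ => (Real.log (E (a ^ n) x - E (a ^ n) (y n)) - Real.log (x - y n)) / n)
      atTop (𝓝 (Real.log (derivWithin (E a) (Icc 0 1) 0))) := by
  set D := derivWithin (E a) (Icc 0 1) with hD
  have h0 : (0 : ℝ) ∈ Icc (0 : ℝ) 1 := by simp
  have hyI : ∀ n, y n ∈ Icc (0 : ℝ) 1 := fun n => ⟨hy0 n, (hyx n).le.trans hx.2⟩
  have hpos : ∀ k n : ℕ, 0 < E (a ^ k) x - E (a ^ k) (y n) := fun k n =>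
    sub_pos.2 (hE.mono _ (hyI n) hx (hyx n))
  set q : ℕ → ℕ → ℝ := fun k n => Real.log (E (a ^ (k + 1)) x - E (a ^ (k + 1)) (y n)) -
    Real.log (E (a ^ k) x - E (a ^ k) (y n)) with hq
  -- By the mean value theorem, the `k`-th step changes the logarithm of the length by `log (D ξ)`
  -- with `0 ≤ ξ ≤ aᵏ x`. This location does not depend on `y n`, whence the uniformity in `n`
  -- below.
  have hmvt : ∀ k n, ∃ ξ ∈ Icc (0 : ℝ) 1, ξ ≤ E (a ^ k) x ∧ q k n = Real.log (D ξ) := by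
    intro k n
    have hu := hE.mapsTo (a ^ k) hx
    have hv := hE.mapsTo (a ^ k) (hyI n)
    have hsub : Icc (E (a ^ k) (y n)) (E (a ^ k) x) ⊆ Icc 0 1 := Icc_subset_Icc hv.1 hu.2
    obtain ⟨ξ, hξ, h1⟩ := exists_hasDerivAt_eq_slope (E a) D (sub_pos.1 (hpos k n))
      ((hE.contDiff a).continuousOn.mono hsub)
      (fun z hz => hE.hasDerivAt a ⟨hv.1.trans_lt hz.1, hz.2.trans_le hu.2⟩)
    refine ⟨ξ, hsub (Ioo_subset_Icc_self hξ), hξ.2.le, ?_⟩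
    rw [h1, ← hE.mul _ _ _ hx, ← hE.mul _ _ _ (hyI n), ← pow_succ',
      Real.log_div (hpos _ _).ne' (hpos _ _).ne']
  have hcont : ContinuousOn (fun ξ => Real.log (D ξ) - Real.log (D 0)) (Icc 0 1) :=
    ((hE.continuousOn_deriv a).log fun z hz => (hE.deriv_pos a hz).ne').sub continuousOn_const
  obtain ⟨C, hC⟩ := isCompact_Icc.exists_bound_of_continuousOn hcont
  have hbdd : ∀ k, BddAbove (range fun n => |q k n - Real.log (D 0)|) := by
    intro k
    refine ⟨C, ?_⟩
    rintro _ ⟨n, rfl⟩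
    obtain ⟨ξ, hξ, -, h1⟩ := hmvt k n
    simp only
    rw [h1]
    exact hC ξ hξ
  -- The supremum over `n` allows the end point `y n` to change with the number of iterations;
  -- averaging over `k < n` is then a Cesàro mean.
  have hη : Tendsto (fun k => ⨆ n, |q k n - Real.log (D 0)|) atTop (𝓝 0) := by
    rw [Metric.tendsto_atTop']
    intro ε hε
    obtain ⟨δ, hδ, hδ'⟩ := Metric.continuousWithinAt_iff.1 (hcont 0 h0) (ε / 2) (by positivity)
    obtain ⟨K, hK⟩ := eventually_atTop.1 (hx0.eventually (gt_mem_nhds hδ))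
    refine ⟨K, fun k hk => ?_⟩
    have h1 : ⨆ n, |q k n - Real.log (D 0)| ≤ ε / 2 := by
      refine ciSup_le fun n => ?_
      obtain ⟨ξ, hξ, hξk, h1⟩ := hmvt k n
      rw [h1]
      have h2 := hδ' hξ (by
        rw [Real.dist_eq, sub_zero, abs_of_nonneg hξ.1]
        exact hξk.trans_lt (hK k hk.le))
      rw [sub_self, Real.dist_eq, sub_zero] at h2
      exact h2.le
    have h2 : 0 ≤ ⨆ n, |q k n - Real.log (D 0)| := Real.iSup_nonneg fun n => abs_nonneg _
    rw [Real.dist_eq, sub_zero, abs_of_nonneg h2]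
    linarith
  rw [tendsto_iff_norm_sub_tendsto_zero]
  refine squeeze_zero' (Eventually.of_forall fun n => norm_nonneg _) ?_ hη.cesaro
  filter_upwards [eventually_gt_atTop 0] with n hn
  have hn' : (0 : ℝ) < n := by exact_mod_cast hn
  have h1 : Real.log (E (a ^ n) x - E (a ^ n) (y n)) - Real.log (x - y n) =
      ∑ k ∈ Finset.range n, q k n := by
    rw [Finset.sum_range_sub (fun k => Real.log (E (a ^ k) x - E (a ^ k) (y n)))]
    simp only [pow_zero]
    rw [hE.one x hx, hE.one _ (hyI n)]
  have h2 : (∑ k ∈ Finset.range n, q k n) / n - Real.log (D 0) =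
      (n : ℝ)⁻¹ * ∑ k ∈ Finset.range n, (q k n - Real.log (D 0)) := by
    rw [Finset.sum_sub_distrib (fun k => q k n), Finset.sum_const, Finset.card_range, nsmul_eq_mul]
    field_simp
  rw [h1, h2, norm_mul, Real.norm_eq_abs, Real.norm_eq_abs, abs_of_pos (inv_pos.2 hn')]
  gcongr
  refine (Finset.abs_sum_le_sum_abs _ _).trans (Finset.sum_le_sum fun k _ => ?_)
  exact le_ciSup (hbdd k) n

end C1Action

/-! ### Growth of displacements for actions tangent to the identity at the end points. -/

/-- A `C¹` action of a group containing a homomorphic image `β` of the abelian group `H`,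
tangent to the identity at both end points, and an element `a` that acts on it by `α`. -/
structure TangentAction {Γ H : Type*} [Group Γ] [AddCommGroup H] (E : Γ → ℝ → ℝ) (a : Γ)
    (β : H → Γ) (α : AddAut H) : Prop extends C1Action E where
  add : ∀ b c, β (b + c) = β b * β c
  semiconj : ∀ b, a * β b = β (α b) * a
  deriv_zero : ∀ b, derivWithin (E (β b)) (Icc 0 1) 0 = 1
  deriv_reverse_zero : ∀ b, derivWithin (fun x => 1 - E (β b) (1 - x)) (Icc 0 1) 0 = 1

namespace TangentAction

variable {Γ H ι : Type*} [Group Γ] [AddCommGroup H] [Fintype ι] {E : Γ → ℝ → ℝ} {a : Γ}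
  {β : H → Γ} {α : AddAut H} {B : ι → H}

/-- Both end points play the same role in the hypotheses, so that every result at `0` can be read at
`1`. -/
theorem reverse (hE : TangentAction E a β α) :
    TangentAction (fun g x => 1 - E g (1 - x)) a β α where
  toC1Action := hE.toC1Action.reverse
  add := hE.add
  semiconj := hE.semiconj
  deriv_zero := hE.deriv_reverse_zero
  deriv_reverse_zero b := by simpa using hE.deriv_zero b

theorem semiconj_zpow (hE : TangentAction E a β α) (k : ℤ) (b : H) :
    a ^ k * β b = β ((k • α) b) * a ^ k := by
  induction k generalizing b with
  | zero => simp
  | succ k ih =>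
    rw [zpow_add_one, mul_assoc, hE.semiconj, ← mul_assoc, ih, mul_assoc, add_zsmul, one_zsmul]
    rfl
  | pred k ih =>
    have h1 : a⁻¹ * β b = β ((-α) b) * a⁻¹ := by
      have := hE.semiconj ((-α) b)
      rw [AddAut.apply_neg_self] at this
      rw [inv_mul_eq_iff_eq_mul, ← mul_assoc, this, mul_assoc, mul_inv_cancel, mul_one]
    rw [zpow_sub_one, mul_assoc, h1, ← mul_assoc, ih, mul_assoc, sub_eq_add_neg (-(k : ℤ)) 1,
      add_zsmul, neg_one_zsmul]
    rfl

theorem map_zero (hE : TangentAction E a β α) : β 0 = 1 := by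
  have := hE.add 0 0
  rw [add_zero] at this
  exact left_eq_mul.1 this

theorem map_neg (hE : TangentAction E a β α) (b : H) : β (-b) = (β b)⁻¹ := by
  rw [eq_inv_iff_mul_eq_one, ← hE.add, neg_add_cancel, hE.map_zero]

/-- Replacing `a` by another element of the group that acts on `H` like a power of `a`. -/
theorem zpow_mul (hE : TangentAction E a β α) (k : ℤ) (c : H) :
    TangentAction E (a ^ k * β c) β (k • α) where
  toC1Action := hE.toC1Action
  add := hE.add
  semiconj b := by
    rw [mul_assoc, ← hE.add, add_comm, hE.add, ← mul_assoc, hE.semiconj_zpow, mul_assoc]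
  deriv_zero := hE.deriv_zero
  deriv_reverse_zero := hE.deriv_reverse_zero

theorem inv (hE : TangentAction E a β α) : TangentAction E a⁻¹ β (-α) := by
  have := hE.zpow_mul (-1) 0
  rwa [hE.map_zero, mul_one, zpow_neg_one, neg_one_zsmul] at this

theorem apply_comm (hE : TangentAction E a β α) (b c : H) {x : ℝ} (hx : x ∈ Icc (0 : ℝ) 1) :
    E (β b) (E (β c) x) = E (β c) (E (β b) x) := by
  rw [← hE.mul _ _ _ hx, ← hE.mul _ _ _ hx, ← hE.add, ← hE.add, add_comm]

theorem apply_pow (hE : TangentAction E a β α) (n : ℕ) (b : H) {x : ℝ}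
    (hx : x ∈ Icc (0 : ℝ) 1) :
    E (β b) (E (a ^ n) x) = E (a ^ n) (E (β (((-(n : ℤ)) • α) b)) x) := by
  rw [← hE.mul _ _ _ hx, ← hE.mul _ _ _ hx]
  congr 1
  have := hE.semiconj_zpow n (((-(n : ℤ)) • α) b)
  rw [← AddAut.add_apply, ← add_zsmul, add_neg_cancel, zero_zsmul, zpow_natCast] at this
  exact this.symm

theorem lt_of_neg (hE : TangentAction E a β α) {φ : H →+ ℝ} {x : ℝ} (hx : x ∈ Icc (0 : ℝ) 1)
    (hφ : ∀ b, 0 < φ b → x < E (β b) x) {b : H} (hb : φ b < 0) : E (β b) x < x := by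
  have h1 := hφ (-b) (by rw [_root_.map_neg]; linarith)
  have h2 := hE.toC1Action.mono (β b) hx (hE.mapsTo _ hx) h1
  rwa [hE.map_neg, hE.apply_inv _ hx] at h2

/-- The growth of the displacement along an orbit of `a` converging to the end point `0`,
together with the asymptotic proportionality to the governing additive function. -/
theorem growth_displacement (hE : TangentAction E a β α) (hB : RationallySpans B) {x : ℝ}
    (hx : x ∈ Icc (0 : ℝ) 1) (hx0 : Tendsto (fun n : ℕ => E (a ^ n) x) atTop (𝓝 0))
    {φ : H →+ ℝ} (hφ0 : φ ≠ 0) (hφ : ∀ b, 0 < φ b → x < E (β b) x) :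
    (∀ n : ℕ, 0 < ∑ i, |E (β (B i)) (E (a ^ n) x) - E (a ^ n) x|) ∧
    (∀ n : ℕ, 0 < ∑ i, |φ (((-(n : ℤ)) • α) (B i))|) ∧
    Tendsto (fun n : ℕ => (Real.log (∑ i, |E (β (B i)) (E (a ^ n) x) - E (a ^ n) x|) -
      Real.log (∑ i, |φ (((-(n : ℤ)) • α) (B i))|)) / n) atTop
      (𝓝 (Real.log (derivWithin (E a) (Icc 0 1) 0))) ∧
    ∀ b, Tendsto (fun n : ℕ => (E (β b) (E (a ^ n) x) - E (a ^ n) x) /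
        (∑ i, |E (β (B i)) (E (a ^ n) x) - E (a ^ n) x|) -
        φ (((-(n : ℤ)) • α) b) / ∑ i, |φ (((-(n : ℤ)) • α) (B i))|) atTop (𝓝 0) := by
  set ν := derivWithin (E a) (Icc 0 1) 0 with hνdef
  have hν0 : 0 < ν := hE.deriv_pos a (by simp)
  set d : H → ℕ → ℝ := fun b n => E (β b) (E (a ^ n) x) - E (a ^ n) x with hd
  -- Since `b aⁿ = aⁿ (α⁻ⁿ b)`, the sign of the displacement of `b` at `aⁿ x` is that of `α⁻ⁿ b` at
  -- `x`, which `φ` governs.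
  set ψ : ℕ → H →+ ℝ := fun n => φ.comp ((-(n : ℤ)) • α).toAddMonoidHom with hψ
  have hψapp : ∀ n b, ψ n b = φ (((-(n : ℤ)) • α) b) := fun n b => rfl
  have hxn : ∀ n : ℕ, E (a ^ n) x ∈ Icc (0 : ℝ) 1 := fun n => hE.mapsTo _ hx
  have hβx : ∀ b (n : ℕ), E (β b) (E (a ^ n) x) ∈ Icc (0 : ℝ) 1 := fun b n =>
    hE.mapsTo _ (hxn n)
  have hβ0 : ∀ b, Tendsto (fun n : ℕ => E (β b) (E (a ^ n) x)) atTop (𝓝 0) := by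
    intro b
    have h1 := (hE.contDiff (β b)).continuousOn 0 (by simp)
    have h2 := h1.tendsto.comp
      (tendsto_nhdsWithin_iff.2 ⟨hx0, Eventually.of_forall hxn⟩)
    rwa [hE.zero] at h2
  have hd0 : ∀ n, d 0 n = 0 := by
    intro n
    simp only [hd, hE.map_zero, hE.one _ (hxn n), sub_self]
  -- Only here is the derivative `1` of `H` at the end point used.
  have hadd : ∀ b c, (fun n => d (b + c) n - d b n - d c n) =o[atTop] d c := by
    intro b c
    have h1 := hE.isLittleO_sub (β b) (hβx c) hxn (hβ0 c) hx0
    rw [hE.deriv_zero] at h1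
    refine h1.congr_left fun n => ?_
    simp only [hd, hE.add, hE.mul _ _ _ (hxn n)]
    ring
  have hψ0 : ∀ n, ψ n ≠ 0 := by
    intro n h0
    apply hφ0
    ext b
    have := DFunLike.congr_fun h0 (((n : ℤ) • α) b)
    rw [hψapp, ← AddAut.add_apply, ← add_zsmul, neg_add_cancel, zero_zsmul] at this
    simpa using this
  have hpos : ∀ n b, 0 < ψ n b → 0 < d b n := by
    intro n b hb
    simp only [hd, sub_pos]
    rw [hE.apply_pow n b hx]
    exact hE.toC1Action.mono _ hx (hE.mapsTo _ hx) (hφ _ hb)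
  have hneg : ∀ n b, ψ n b < 0 → d b n < 0 := by
    intro n b hb
    simp only [hd, sub_neg]
    rw [hE.apply_pow n b hx]
    exact hE.toC1Action.mono _ (hE.mapsTo _ hx) hx (hE.lt_of_neg hx hφ hb)
  have hα : ∀ n b, ψ (n + 1) (α b) = ψ n b := by
    intro n b
    rw [hψapp, hψapp]
    congr 1
    have : α b = ((1 : ℤ) • α) b := by simp
    rw [this, ← AddAut.add_apply, ← add_zsmul]
    congr 2
    push_cast
    ring
  have hν : ∀ b, (fun n => d (α b) (n + 1) - ν * d b n) =o[atTop] d b := by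
    intro b
    refine (hE.isLittleO_sub a (hβx b) hxn (hβ0 b) hx0).congr_left fun n => ?_
    have h1 : E (a ^ (n + 1)) x = E a (E (a ^ n) x) := by
      rw [pow_succ', hE.mul _ _ _ hx]
    simp only [hd]
    rw [h1, ← hE.mul (β (α b)) a _ (hxn n), ← hE.semiconj, hE.mul _ _ _ (hxn n)]
  have hN : ∀ n, 0 < ∑ i, |d (B i) n| := fun n =>
    sum_abs_pos_of_sign hB (hψ0 n) (e := fun b => d b n) (hpos n) (hneg n)
  have hS : ∀ n, 0 < ∑ i, |ψ n (B i)| := fun n => sum_abs_pos_of_rationallySpans hB (hψ0 n)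
  refine ⟨hN, hS, ?_, tendsto_displacement_sub_addMonoidHom hB hd0 hadd hψ0 hpos hneg⟩
  have h1 := tendsto_ratio_displacement hB hd0 hadd hψ0 hpos hneg α hα hν
  rw [abs_of_pos hν0] at h1
  refine (tendsto_log_div_of_ratio (fun n => div_pos (hN n) (hS n)) hν0 h1).congr fun n => ?_
  rw [Real.log_div (hN n).ne' (hS n).ne']
  rfl

/-- If the orbit of `a` through `x` converges to `0` and the orbit of `x` under `H` stays between
two common fixed points, the governing additive function grows subexponentially. -/
theorem subexponential_of_fixed (hE : TangentAction E a β α) (hB : RationallySpans B)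
    {x u v : ℝ} (hx : x ∈ Icc (0 : ℝ) 1) (hu : u ∈ Icc (0 : ℝ) 1) (hv : v ∈ Icc (0 : ℝ) 1)
    (hux : u ≤ x) (hxv : x ≤ v) (huv : u < v)
    (hv0 : Tendsto (fun n : ℕ => E (a ^ n) v) atTop (𝓝 0))
    (hufix : ∀ b, E (β b) u = u) (hvfix : ∀ b, E (β b) v = v)
    {φ : H →+ ℝ} (hφ : ∀ b, 0 < φ b → x < E (β b) x) (b : H) {ε : ℝ} (hε : 0 < ε) :
    ∃ C, ∀ n : ℕ, |φ (((-(n : ℤ)) • α) b)| ≤ C * Real.exp (ε * n) := by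
  rcases eq_or_ne φ 0 with rfl | hφ0
  · exact ⟨0, by simp⟩
  have hx0 : Tendsto (fun n : ℕ => E (a ^ n) x) atTop (𝓝 0) :=
    squeeze_zero (fun n => (hE.mapsTo _ hx).1) (fun n => (hE.le_iff _ hx hv).2 hxv) hv0
  obtain ⟨hN, hS, h1, -⟩ := hE.growth_displacement hB hx hx0 hφ0 hφ
  set N : ℕ → ℝ := fun n => ∑ i, |E (β (B i)) (E (a ^ n) x) - E (a ^ n) x| with hNdef
  set S : ℕ → ℝ := fun n => ∑ i, |φ (((-(n : ℤ)) • α) (B i))| with hSdef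
  replace hN : ∀ n, 0 < N n := hN
  replace hS : ∀ n, 0 < S n := hS
  have h2 := hE.tendsto_log_length a hv hv0 (y := fun _ => u) (fun _ => hu.1) (fun _ => huv)
  have hfixn : ∀ (w : ℝ) (_ : w ∈ Icc (0 : ℝ) 1) (_ : ∀ b, E (β b) w = w) (n : ℕ) (b : H),
      E (β b) (E (a ^ n) w) = E (a ^ n) w := by
    intro w hw hwfix n b
    rw [hE.apply_pow n b hw, hwfix]
  have hlen : ∀ n, 0 < E (a ^ n) v - E (a ^ n) u := fun n =>
    sub_pos.2 ((hE.lt_iff _ hu hv).2 huv)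
  -- `aⁿ u` and `aⁿ v` are again fixed by `H`, so no element of `H` moves `aⁿ x` by more than their
  -- distance.
  have hNle : ∀ n, N n ≤ (Fintype.card ι : ℝ) * (E (a ^ n) v - E (a ^ n) u) := by
    intro n
    rw [← nsmul_eq_mul, ← Finset.card_univ, ← Finset.sum_const]
    refine Finset.sum_le_sum fun i _ => ?_
    have a1 := (hE.le_iff (a ^ n) hu hx).2 hux
    have a2 := (hE.le_iff (a ^ n) hx hv).2 hxv
    have a3 := (hE.le_iff (β (B i)) (hE.mapsTo (a ^ n) hu) (hE.mapsTo _ hx)).2 a1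
    have a4 := (hE.le_iff (β (B i)) (hE.mapsTo (a ^ n) hx) (hE.mapsTo _ hv)).2 a2
    rw [hfixn u hu hufix] at a3
    rw [hfixn v hv hvfix] at a4
    rw [abs_le]
    constructor <;> linarith
  have hcard : (0 : ℝ) < Fintype.card ι := by
    by_contra! h0
    have h3 := hNle 0
    have h4 := mul_nonpos_of_nonpos_of_nonneg h0 (hlen 0).le
    have h5 := hN 0
    have h6 : (Fintype.card ι : ℝ) = 0 := le_antisymm h0 (by positivity)
    rw [h6, zero_mul] at h3
    linarith
  have hconst : ∀ c : ℝ, Tendsto (fun n : ℕ => c / n) atTop (𝓝 0) := fun c =>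
    tendsto_const_div_atTop_nhds_zero_nat c
  -- The displacements relative to `S` and the length of `aⁿ [u, v]` have the same rate `log Da(0)`;
  -- their difference bounds the growth of `S`.
  have h3 := ((h2.sub h1).add (hconst (Real.log (Fintype.card ι) + Real.log (v - u))))
  rw [sub_self, zero_add] at h3
  obtain ⟨K, hK⟩ := eventually_atTop.1 (h3.eventually (gt_mem_nhds hε))
  obtain ⟨C, hC0, hC⟩ := addMonoidHom_bound_of_rationallySpans hB b
  have hφS : ∀ n : ℕ, |φ (((-(n : ℤ)) • α) b)| ≤ C * S n := fun n =>
    hC (φ.comp ((-(n : ℤ)) • α).toAddMonoidHom)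
  -- Starting at `K + 1` excludes `n = 0`, where the quotient by `n` carries no information.
  have hSev : ∀ n, K + 1 ≤ n → S n ≤ Real.exp (ε * n) := by
    intro n hn
    have hn' : (0 : ℝ) < n := by exact_mod_cast (by omega : 0 < n)
    have h4 := hK n (by omega)
    rw [div_sub_div_same, ← add_div, div_lt_iff₀ hn'] at h4
    have h5 := Real.log_le_log (hN n) (hNle n)
    rw [Real.log_mul hcard.ne' (hlen n).ne'] at h5
    rw [← Real.log_le_iff_le_exp (hS n)]
    change Real.log (E (a ^ n) v - E (a ^ n) u) - Real.log (v - u) -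
      (Real.log (N n) - Real.log (S n)) +
      (Real.log (Fintype.card ι) + Real.log (v - u)) < ε * n at h4
    linarith
  refine ⟨C * (1 + ∑ n ∈ Finset.range (K + 1), S n), fun n => (hφS n).trans ?_⟩
  rw [mul_assoc]
  refine mul_le_mul_of_nonneg_left ?_ hC0
  have hexp : 1 ≤ Real.exp (ε * n) := Real.one_le_exp (by positivity)
  have hsum : 0 ≤ ∑ n ∈ Finset.range (K + 1), S n := Finset.sum_nonneg fun n _ => (hS n).le
  rcases lt_or_ge n (K + 1) with h | h
  · have : S n ≤ ∑ n ∈ Finset.range (K + 1), S n :=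
      Finset.single_le_sum (f := S) (fun n _ => (hS n).le) (Finset.mem_range.2 h)
    nlinarith
  · have := hSev n h
    nlinarith

/-- If the governing additive function is dilated by `r`, so are the displacements of the
elements `α⁻ⁿ b` at a fixed point, up to a subexponential error. -/
theorem tendsto_log_displacement (hE : TangentAction E a β α) (hB : RationallySpans B) {x : ℝ}
    (hx : x ∈ Icc (0 : ℝ) 1) (hx0 : Tendsto (fun n : ℕ => E (a ^ n) x) atTop (𝓝 0))
    {φ : H →+ ℝ} (hφ : ∀ b, 0 < φ b → x < E (β b) x) {r : ℝ} (hr : 0 < r)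
    (hα : ∀ b, φ (α b) = r * φ b) {b : H} (hb : φ b < 0) :
    Tendsto (fun n : ℕ => Real.log (x - E (β (((-(n : ℤ)) • α) b)) x) / n) atTop
      (𝓝 (-Real.log r)) := by
  have hφ0 : φ ≠ 0 := by rintro rfl; simp at hb
  have hpow : ∀ (n : ℕ) c, φ (((-(n : ℤ)) • α) c) = (r ^ n)⁻¹ * φ c := by
    intro n c
    have h1 : ∀ (n : ℕ) c, φ ((n • α) c) = r ^ n * φ c := by
      intro n
      induction n with
      | zero => simp
      | succ n ih =>
        intro c
        rw [succ_nsmul, AddAut.add_apply, ih, hα, pow_succ, mul_assoc]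
    have h2 := h1 n (((-(n : ℤ)) • α) c)
    rw [← AddAut.add_apply, ← natCast_zsmul, ← add_zsmul, add_neg_cancel, zero_zsmul,
      AddAut.zero_apply] at h2
    rw [h2, inv_mul_cancel_left₀ (by positivity)]
  obtain ⟨hN, hS, h1, h2⟩ := hE.growth_displacement hB hx hx0 hφ0 hφ
  set N : ℕ → ℝ := fun n => ∑ i, |E (β (B i)) (E (a ^ n) x) - E (a ^ n) x| with hNdef
  replace hN : ∀ n, 0 < N n := hN
  set s := ∑ i, |φ (B i)| with hs
  have hs0 : 0 < s := by simpa using hS 0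
  have hSn : ∀ n : ℕ, ∑ i, |φ (((-(n : ℤ)) • α) (B i))| = (r ^ n)⁻¹ * s := by
    intro n
    simp only [hpow, abs_mul, ← Finset.mul_sum]
    rw [abs_of_pos (by positivity)]
  have hφn : ∀ n : ℕ, φ (((-(n : ℤ)) • α) b) / ∑ i, |φ (((-(n : ℤ)) • α) (B i))| = φ b / s := by
    intro n
    rw [hSn, hpow, mul_div_mul_left _ _ (by positivity)]
  set y : ℕ → ℝ := fun n => E (β (((-(n : ℤ)) • α) b)) x with hy
  have hyI : ∀ n, y n ∈ Icc (0 : ℝ) 1 := fun n => hE.mapsTo _ hx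
  have hyx : ∀ n, y n < x := by
    intro n
    refine hE.lt_of_neg hx hφ ?_
    rw [hpow]
    exact mul_neg_of_pos_of_neg (by positivity) hb
  -- The displacement of `b` at `aⁿ x` is also the length of `aⁿ [y n, x]`. Its logarithm is
  -- computed in both ways, and the unknown rate `log Da(0)` cancels.
  have hd : ∀ n : ℕ, E (β b) (E (a ^ n) x) = E (a ^ n) (y n) := fun n => hE.apply_pow n b hx
  have hdpos : ∀ n : ℕ, 0 < E (a ^ n) x - E (a ^ n) (y n) := fun n =>
    sub_pos.2 ((hE.lt_iff _ (hyI n) hx).2 (hyx n))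
  have h3 := hE.tendsto_log_length a hx hx0 (fun n => (hyI n).1) hyx
  have h4 : Tendsto (fun n : ℕ => (E (a ^ n) x - E (a ^ n) (y n)) / N n) atTop
      (𝓝 (-(φ b / s))) := by
    have := ((h2 b).add_const (φ b / s)).neg
    rw [zero_add] at this
    refine this.congr fun n => ?_
    rw [hφn, hd]
    change -((E (a ^ n) (y n) - E (a ^ n) x) / N n - φ b / s + φ b / s) = _
    ring
  have hκ : 0 < -(φ b / s) := by
    rw [neg_pos]
    exact div_neg_of_neg_of_pos hb hs0
  have h5 := (Real.continuousAt_log hκ.ne').tendsto.comp h4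
  have h6 : Tendsto (fun n : ℕ => Real.log ((E (a ^ n) x - E (a ^ n) (y n)) / N n) / n) atTop
      (𝓝 0) := h5.div_atTop tendsto_natCast_atTop_atTop
  have h7 : Tendsto (fun n : ℕ => Real.log s / n - Real.log r) atTop (𝓝 (0 - Real.log r)) :=
    (tendsto_const_div_atTop_nhds_zero_nat _).sub_const _
  have h8 := ((h1.add h7).add h6).sub h3
  have e : Real.log (derivWithin (E a) (Icc 0 1) 0) + (0 - Real.log r) + 0 -
      Real.log (derivWithin (E a) (Icc 0 1) 0) = -Real.log r := by ring
  rw [e] at h8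
  refine h8.congr' ?_
  filter_upwards [eventually_gt_atTop 0] with n hn
  have hn' : (n : ℝ) ≠ 0 := by positivity
  rw [hSn, Real.log_mul (by positivity) hs0.ne', Real.log_inv, Real.log_pow,
    Real.log_div (hdpos n).ne' (hN n).ne']
  change (Real.log (N n) - _) / _ + _ + _ - _ = _
  field_simp
  ring

end TangentAction

theorem AddMonoidHom.exists_neg_of_ne_zero {H : Type*} [AddCommGroup H] {φ : H →+ ℝ}
    (hφ : φ ≠ 0) : ∃ b, φ b < 0 := by
  by_contra! hcon
  apply hφ
  ext b
  have h1 := hcon b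
  have h2 := hcon (-b)
  simp only [map_neg, AddMonoidHom.zero_apply] at *
  linarith

theorem apply_zsmul_addAut {H : Type*} [AddCommGroup H] {φ : H →+ ℝ} {α : AddAut H} {r : ℝ}
    (hr : r ≠ 0) (hα : ∀ b, φ (α b) = r * φ b) (k : ℤ) (b : H) :
    φ ((k • α) b) = r ^ k * φ b := by
  induction k generalizing b with
  | zero => simp
  | succ k ih =>
    rw [add_zsmul, one_zsmul, AddAut.add_apply, ih, hα, zpow_add_one₀ hr, mul_assoc]
  | pred k ih =>
    have h1 := hα ((-α) b)
    rw [AddAut.apply_neg_self] at h1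
    rw [sub_eq_add_neg (-(k : ℤ)) 1, add_zsmul, neg_one_zsmul, AddAut.add_apply, ih, h1,
      ← sub_eq_add_neg, zpow_sub_one₀ hr, mul_assoc, inv_mul_cancel_left₀ hr]

namespace TangentAction

variable {Γ H ι : Type*} [Group Γ] [AddCommGroup H] [Fintype ι] {E : Γ → ℝ → ℝ} {a : Γ}
  {β : H → Γ} {α : AddAut H} {B : ι → H}

/-! ### Monotone semiconjugacies to affine actions -/

/-- `F` is a monotone function on `(0,1)` that semiconjugates `β b` to the translation by `φ b`
and `a` to the affine map `t ↦ r t + c`. -/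
structure SemiAffine (E : Γ → ℝ → ℝ) (a : Γ) (β : H → Γ) (α : AddAut H) (φ : H →+ ℝ)
    (F : ℝ → ℝ) (r c : ℝ) : Prop where
  ne_zero : φ ≠ 0
  monotoneOn : MonotoneOn F (Ioo 0 1)
  translation : ∀ b, ∀ x ∈ Ioo (0 : ℝ) 1, F (E (β b) x) = F x + φ b
  affine : ∀ x ∈ Ioo (0 : ℝ) 1, F (E a x) = r * F x + c
  dilate : ∀ b, φ (α b) = r * φ b

namespace SemiAffine

variable {φ : H →+ ℝ} {F : ℝ → ℝ} {r c : ℝ}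

theorem inv (hF : SemiAffine E a β α φ F r c) (hE : TangentAction E a β α) (hr : r ≠ 0) :
    SemiAffine E a⁻¹ β (-α) φ F r⁻¹ (-(r⁻¹ * c)) where
  ne_zero := hF.ne_zero
  monotoneOn := hF.monotoneOn
  translation := hF.translation
  affine x hx := by
    have := hF.affine _ (hE.mapsTo_Ioo a⁻¹ hx)
    rw [hE.apply_inv a (Ioo_subset_Icc_self hx)] at this
    rw [this]
    field_simp
    ring
  dilate b := by
    have := hF.dilate ((-α) b)
    rw [AddAut.apply_neg_self] at this
    rw [this, inv_mul_cancel_left₀ hr]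

theorem lt_apply (hF : SemiAffine E a β α φ F r c) (hE : TangentAction E a β α) {x : ℝ}
    (hx : x ∈ Ioo (0 : ℝ) 1) {b : H} (hb : 0 < φ b) : x < E (β b) x := by
  by_contra! hcon
  have := hF.monotoneOn (hE.mapsTo_Ioo _ hx) hx hcon
  rw [hF.translation b x hx] at this
  linarith

theorem lt_of_lt (hF : SemiAffine E a β α φ F r c) {x y : ℝ} (hx : x ∈ Ioo (0 : ℝ) 1)
    (hy : y ∈ Ioo (0 : ℝ) 1) (h : F x < F y) : x < y := by
  by_contra! hcon
  exact absurd (hF.monotoneOn hy hx hcon) (not_le.2 h)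

theorem affine_pow (hF : SemiAffine E a β α φ F r c) (hE : TangentAction E a β α) (hr : r ≠ 1)
    {x : ℝ} (hx : x ∈ Ioo (0 : ℝ) 1) (n : ℕ) :
    F (E (a ^ n) x) = c / (1 - r) + r ^ n * (F x - c / (1 - r)) := by
  have h1 : 1 - r ≠ 0 := sub_ne_zero.2 hr.symm
  induction n with
  | zero => rw [pow_zero, hE.one x (Ioo_subset_Icc_self hx)]; ring
  | succ n ih =>
    rw [pow_succ', hE.mul _ _ _ (Ioo_subset_Icc_self hx), hF.affine _ (hE.mapsTo_Ioo _ hx), ih]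
    field_simp
    ring

/-- To the left of the fixed point `c / (1 - r)` the affine map pushes to `-∞`. An interior limit of
the orbit would bound `F` below along it. -/
theorem tendsto_zero (hF : SemiAffine E a β α φ F r c) (hE : TangentAction E a β α) (hr : 1 < r)
    {x : ℝ} (hx : x ∈ Ioo (0 : ℝ) 1) (hxt : F x < c / (1 - r)) :
    Tendsto (fun n : ℕ => E (a ^ n) x) atTop (𝓝 0) := by
  have hI : ∀ n : ℕ, E (a ^ n) x ∈ Ioo (0 : ℝ) 1 := fun n => hE.mapsTo_Ioo _ hx
  have hFn := hF.affine_pow hE hr.ne' hx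
  have hanti : Antitone fun n : ℕ => E (a ^ n) x := by
    refine antitone_nat_of_succ_le fun n => (hF.lt_of_lt (hI _) (hI _) ?_).le
    rw [hFn, hFn, pow_succ]
    have : 0 < r ^ n := by positivity
    nlinarith [mul_pos this (sub_pos.2 hxt), mul_pos (mul_pos this (sub_pos.2 hxt)) (sub_pos.2 hr)]
  have hbdd : BddBelow (range fun n : ℕ => E (a ^ n) x) := ⟨0, by
    rintro _ ⟨n, rfl⟩; exact (hI n).1.le⟩
  have hlim := tendsto_atTop_ciInf hanti hbdd
  set ℓ := ⨅ n : ℕ, E (a ^ n) x with hℓ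
  have hℓle : ∀ n : ℕ, ℓ ≤ E (a ^ n) x := fun n => ciInf_le hbdd n
  have hℓ0 : 0 ≤ ℓ := le_ciInf fun n => (hI n).1.le
  rcases hℓ0.eq_or_lt with h | h
  · rwa [← h] at hlim
  exfalso
  have hℓI : ℓ ∈ Ioo (0 : ℝ) 1 := ⟨h, (hℓle 0).trans_lt (hI 0).2⟩
  have h1 : Tendsto (fun n : ℕ => r ^ n * (c / (1 - r) - F x)) atTop atTop :=
    (tendsto_pow_atTop_atTop_of_one_lt hr).atTop_mul_const (sub_pos.2 hxt)
  obtain ⟨n, hn⟩ := (h1.eventually (eventually_gt_atTop (c / (1 - r) - F ℓ))).exists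
  have h2 := hF.monotoneOn hℓI (hI n) (hℓle n)
  rw [hFn] at h2
  linarith

/-- There are no wandering intervals. -/
theorem strictMonoOn_of_one_lt (hF : SemiAffine E a β α φ F r c) (hE : TangentAction E a β α)
    (hB : RationallySpans B) (hr : 1 < r) : StrictMonoOn F (Ioo 0 1) := by
  intro u hu v hv huv
  refine lt_of_le_of_ne (hF.monotoneOn hu hv huv.le) fun heq => ?_
  obtain ⟨b, hb⟩ := AddMonoidHom.exists_neg_of_ne_zero hF.ne_zero
  -- A suitable multiple of `b` moves the interval to the left of the fixed point of the affine map,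
  -- where the iterates of `a` converge to `0`.
  obtain ⟨k, hk⟩ := exists_nat_gt ((F u - c / (1 - r)) / (-φ b))
  rw [div_lt_iff₀ (by linarith)] at hk
  set u' := E (β (k • b)) u with hu'
  set v' := E (β (k • b)) v with hv'
  have hu'I : u' ∈ Ioo (0 : ℝ) 1 := hE.mapsTo_Ioo _ hu
  have hv'I : v' ∈ Ioo (0 : ℝ) 1 := hE.mapsTo_Ioo _ hv
  have hu'v' : u' < v' :=
    (hE.lt_iff _ (Ioo_subset_Icc_self hu) (Ioo_subset_Icc_self hv)).2 huv
  have hFu : F u' = F u + k * φ b := by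
    rw [hu', hF.translation _ u hu, map_nsmul, nsmul_eq_mul]
  have hFv : F v' = F u' := by
    rw [hu', hv', hF.translation _ v hv, hF.translation _ u hu, heq]
  have h1 := hE.tendsto_log_displacement hB (Ioo_subset_Icc_self hv'I)
    (hF.tendsto_zero hE hr hv'I (by rw [hFv, hFu]; linarith))
    (fun b hb => hF.lt_apply hE hv'I hb) (by linarith) hF.dilate hb
  -- The element `α⁻ⁿ b` strictly decreases `F`, hence moves `v'` across the whole interval `[u',
  -- v']` on which `F` is constant. This is incompatible with displacements that decay
  -- exponentially.
  have h2 : ∀ n : ℕ, v' - u' ≤ v' - E (β ((-(n : ℤ) • α) b)) v' := by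
    intro n
    have hlt : E (β ((-(n : ℤ) • α) b)) v' < u' := by
      refine hF.lt_of_lt (hE.mapsTo_Ioo _ hv'I) hu'I ?_
      rw [hF.translation _ _ hv'I, hFv, apply_zsmul_addAut (by linarith) hF.dilate]
      have : r ^ (-(n : ℤ)) * φ b < 0 := mul_neg_of_pos_of_neg (by positivity) hb
      linarith
    linarith
  have h3 : Tendsto (fun n : ℕ => Real.log (v' - u') / n) atTop (𝓝 0) :=
    tendsto_const_div_atTop_nhds_zero_nat _
  have h4 : 0 ≤ -Real.log r := by
    refine le_of_tendsto_of_tendsto' h3 h1 fun n => ?_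
    have := Real.log_le_log (sub_pos.2 hu'v') (h2 n)
    gcongr
  linarith [Real.log_pos hr]

theorem strictMonoOn (hF : SemiAffine E a β α φ F r c) (hE : TangentAction E a β α)
    (hB : RationallySpans B) (hr0 : 0 < r) (hr1 : r ≠ 1) : StrictMonoOn F (Ioo 0 1) := by
  rcases lt_or_gt_of_ne hr1 with h | h
  · exact (hF.inv hE hr0.ne').strictMonoOn_of_one_lt hE.inv hB ((one_lt_inv₀ hr0).2 h)
  · exact hF.strictMonoOn_of_one_lt hE hB h

/-- The displacement of `α⁻ⁿ b` is measured at two points. At `x = b p`, whose orbit under `a` tends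
to `0`, it decays at the rate `-log r`. At `p` it decays at the rate `-log Da(p)`, since `a` carries
each image of `p` to the preceding one. By commutativity `b` carries the second displacement to the
first, with distortion bounded near `p`, so the rates agree. -/
theorem deriv_fixed_of_one_lt (hF : SemiAffine E a β α φ F r c) (hE : TangentAction E a β α)
    (hB : RationallySpans B) (hr : 1 < r) {p : ℝ} (hp : p ∈ Ioo (0 : ℝ) 1) (hap : E a p = p) :
    derivWithin (E a) (Icc 0 1) p = r := by
  have hr0 : 0 < r := by linarith
  have hpI := Ioo_subset_Icc_self hp
  have hinj := (hF.strictMonoOn_of_one_lt hE hB hr).injOn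
  have hFp : F p = c / (1 - r) := by
    have := hF.affine p hp
    rw [hap] at this
    rw [eq_div_iff (by linarith)]
    linarith
  obtain ⟨b, hb⟩ := AddMonoidHom.exists_neg_of_ne_zero hF.ne_zero
  set x := E (β b) p with hx
  have hxI : x ∈ Ioo (0 : ℝ) 1 := hE.mapsTo_Ioo _ hp
  have hlog := hE.tendsto_log_displacement hB (Ioo_subset_Icc_self hxI)
    (hF.tendsto_zero hE hr hxI (by rw [hx, hF.translation b p hp, hFp]; linarith))
    (fun b hb => hF.lt_apply hE hxI hb) hr0 hF.dilate hb
  set y : ℕ → ℝ := fun n => E (β ((-(n : ℤ) • α) b)) p with hy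
  have hyI : ∀ n, y n ∈ Ioo (0 : ℝ) 1 := fun n => hE.mapsTo_Ioo _ hp
  have hFy : ∀ n, F (y n) = F p + (r ^ n)⁻¹ * φ b := by
    intro n
    rw [hy]
    simp only
    rw [hF.translation _ p hp, apply_zsmul_addAut hr0.ne' hF.dilate, zpow_neg, zpow_natCast]
  have hyp : ∀ n, y n < p := by
    intro n
    refine hF.lt_of_lt (hyI n) hp ?_
    rw [hFy]
    have : (r ^ n)⁻¹ * φ b < 0 := mul_neg_of_pos_of_neg (by positivity) hb
    linarith
  have hymono : Monotone y := by
    refine monotone_nat_of_le_succ fun n => (hF.lt_of_lt (hyI _) (hyI _) ?_).le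
    rw [hFy, hFy]
    have : (r ^ (n + 1))⁻¹ < (r ^ n)⁻¹ :=
      inv_strictAnti₀ (by positivity) (pow_lt_pow_right₀ hr (Nat.lt_succ_self n))
    nlinarith
  have hbdd : BddAbove (range y) := ⟨p, by rintro _ ⟨n, rfl⟩; exact (hyp n).le⟩
  have hylim : Tendsto y atTop (𝓝 p) := by
    have h1 := tendsto_atTop_ciSup hymono hbdd
    set ℓ := ⨆ n, y n with hℓ
    have hℓp : ℓ ≤ p := ciSup_le fun n => (hyp n).le
    have hℓy : ∀ n, y n ≤ ℓ := fun n => le_ciSup hbdd n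
    have hℓI : ℓ ∈ Ioo (0 : ℝ) 1 := ⟨(hyI 0).1.trans_le (hℓy 0), hℓp.trans_lt hp.2⟩
    have h2 : Tendsto (fun n : ℕ => F p + (r ^ n)⁻¹ * φ b) atTop (𝓝 (F p)) := by
      have := ((tendsto_inv_atTop_zero.comp
        (tendsto_pow_atTop_atTop_of_one_lt hr)).mul_const (φ b)).const_add (F p)
      rw [zero_mul, add_zero] at this
      exact this
    -- With the reverse inequality, injectivity of `F` identifies the limit with `p`; this rests on
    -- the absence of wandering intervals.
    have h3 : F p ≤ F ℓ := by
      refine le_of_tendsto' h2 fun n => ?_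
      rw [← hFy]
      exact hF.monotoneOn (hyI n) hℓI (hℓy n)
    have h4 : ℓ = p := hinj hℓI hp (le_antisymm (hF.monotoneOn hℓI hp hℓp) h3)
    rwa [h4] at h1
  have hylim' : Tendsto y atTop (𝓝[≠] p) :=
    tendsto_nhdsWithin_iff.2 ⟨hylim, Eventually.of_forall fun n => (hyp n).ne⟩
  have hslope : ∀ g, Tendsto (fun n => (E g p - E g (y n)) / (p - y n)) atTop
      (𝓝 (derivWithin (E g) (Icc 0 1) p)) := by
    intro g
    refine ((hasDerivAt_iff_tendsto_slope.1 (hE.hasDerivAt g hp)).comp hylim').congr fun n => ?_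
    rw [Function.comp_apply, slope_def_field, ← neg_div_neg_eq, neg_sub, neg_sub]
  set μ := derivWithin (E a) (Icc 0 1) p with hμ
  have hμ0 : 0 < μ := hE.deriv_pos a hpI
  have hw : ∀ n, 0 < p - y n := fun n => sub_pos.2 (hyp n)
  have hay : ∀ n, E a (y (n + 1)) = y n := by
    intro n
    simp only [hy]
    rw [← hE.mul _ _ _ hpI, hE.semiconj, hE.mul _ _ _ hpI, hap]
    congr 2
    have h1 : α = (1 : ℤ) • α := by simp
    conv_lhs => rw [h1, one_zsmul, ← AddAut.add_apply]
    congr 1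
    conv_lhs => enter [1]; rw [h1]
    rw [← add_zsmul]
    congr 1
    push_cast
    ring
  have h1 : Tendsto (fun n => (p - y (n + 1)) / (p - y n)) atTop (𝓝 μ⁻¹) := by
    refine (((hslope a).comp (tendsto_add_atTop_nat 1)).inv₀ hμ0.ne').congr fun n => ?_
    simp only [Function.comp_apply]
    rw [hap, hay, inv_div]
  have h2 := tendsto_log_div_of_ratio hw (inv_pos.2 hμ0) h1
  have hκ := hE.deriv_pos (β b) hpI
  have h3 : Tendsto (fun n : ℕ => Real.log ((E (β b) p - E (β b) (y n)) / (p - y n)) / n) atTop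
      (𝓝 0) :=
    ((Real.continuousAt_log hκ.ne').tendsto.comp (hslope (β b))).div_atTop
      tendsto_natCast_atTop_atTop
  have h4 := h2.add h3
  rw [add_zero] at h4
  have h5 := tendsto_nhds_unique hlog (h4.congr fun n => by
    have hlt : 0 < E (β b) p - E (β b) (y n) :=
      sub_pos.2 ((hE.lt_iff _ (Ioo_subset_Icc_self (hyI n)) hpI).2 (hyp n))
    rw [Real.log_div hlt.ne' (hw n).ne', ← add_div, add_sub_cancel, hx,
      hE.apply_comm _ _ hpI])
  rw [Real.log_inv, neg_inj] at h5
  exact (Real.log_injOn_pos hr0 hμ0 h5).symm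

/-- The derivative at an interior fixed point is the ratio of the affine map. -/
theorem deriv_fixed (hF : SemiAffine E a β α φ F r c) (hE : TangentAction E a β α)
    (hB : RationallySpans B) (hr0 : 0 < r) (hr1 : r ≠ 1) {p : ℝ} (hp : p ∈ Ioo (0 : ℝ) 1)
    (hap : E a p = p) : derivWithin (E a) (Icc 0 1) p = r := by
  rcases lt_or_gt_of_ne hr1 with h | h
  · have hpI := Ioo_subset_Icc_self hp
    have hap' : E a⁻¹ p = p := by
      conv_lhs => rw [← hap]
      exact hE.inv_apply a hpI
    have h1 := (hF.inv hE hr0.ne').deriv_fixed_of_one_lt hE.inv hB ((one_lt_inv₀ hr0).2 h) hp hap'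
    have h2 := hE.deriv_mul a⁻¹ a hpI
    rw [inv_mul_cancel, hE.deriv_one hpI, hap, h1] at h2
    exact ((inv_mul_eq_one₀ hr0.ne').1 h2.symm).symm
  · exact hF.deriv_fixed_of_one_lt hE hB h hp hap

end SemiAffine

end TangentAction

/-! ### Hyperbolicity, expressed through additive functions. -/

/-- The only additive function whose composition with the powers of `α` grows subexponentially,
both in the future and in the past, is zero. -/
def SubexponentialTrivial {H : Type*} [AddCommGroup H] (α : AddAut H) : Prop :=
  ∀ φ : H →+ ℝ, (∀ b, ∀ ε : ℝ, 0 < ε →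
    ∃ C : ℝ, ∀ n : ℕ, |φ (((n : ℤ) • α) b)| ≤ C * Real.exp (ε * n)) →
    (∀ b, ∀ ε : ℝ, 0 < ε →
      ∃ C : ℝ, ∀ n : ℕ, |φ ((-(n : ℤ) • α) b)| ≤ C * Real.exp (ε * n)) → φ = 0

theorem SubexponentialTrivial.neg {H : Type*} [AddCommGroup H] {α : AddAut H}
    (h : SubexponentialTrivial α) : SubexponentialTrivial (-α) := by
  intro φ h1 h2
  refine h φ ?_ ?_
  · simpa only [zsmul_neg, neg_zsmul, neg_neg] using h2
  · simpa only [zsmul_neg, neg_zsmul, neg_neg] using h1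

/-- Invariant additive functions vanish. -/
theorem SubexponentialTrivial.eq_zero_of_invariant {H : Type*} [AddCommGroup H] {α : AddAut H}
    (h : SubexponentialTrivial α) {φ : H →+ ℝ} (hφ : ∀ b, φ (α b) = φ b) : φ = 0 := by
  have h1 : ∀ (k : ℤ) b, φ ((k • α) b) = φ b := by
    intro k b
    rw [apply_zsmul_addAut one_ne_zero (fun b => by rw [hφ, one_mul]), one_zpow, one_mul]
  refine h φ ?_ ?_ <;>
  · intro b ε hε
    refine ⟨|φ b|, fun n => ?_⟩
    rw [h1]
    exact le_mul_of_one_le_right (abs_nonneg _) (Real.one_le_exp (by positivity))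

namespace TangentAction

variable {Γ H ι : Type*} [Group Γ] [AddCommGroup H] [Fintype ι] {E : Γ → ℝ → ℝ} {a : Γ}
  {β : H → Γ} {α : AddAut H} {B : ι → H}

/-! ### Actions with a common fixed point of `H` -/

theorem fixed_apply (hE : TangentAction E a β α) (k : ℤ) {w : ℝ} (hw : w ∈ Icc (0 : ℝ) 1)
    (hwfix : ∀ b, E (β b) w = w) (b : H) : E (β b) (E (a ^ k) w) = E (a ^ k) w := by
  have h1 := hE.semiconj_zpow k ((-k • α) b)
  rw [← AddAut.add_apply, ← add_zsmul, add_neg_cancel, zero_zsmul, AddAut.zero_apply] at h1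
  rw [← hE.mul _ _ _ hw, ← h1, hE.mul _ _ _ hw, hwfix]

/-- The orbit decreases inside the closed, `a`-invariant set of points fixed by `H`. An interior
limit would be fixed by `a` and by `H`. -/
theorem tendsto_zero_of_fixed (hE : TangentAction E a β α)
    (hfix : ∀ x ∈ Ioo (0 : ℝ) 1, (∀ b, E (β b) x = x) → E a x ≠ x) {w : ℝ}
    (hw : w ∈ Ioo (0 : ℝ) 1) (hwfix : ∀ b, E (β b) w = w) (haw : E a w < w) :
    Tendsto (fun n : ℕ => E (a ^ n) w) atTop (𝓝 0) := by
  have hwI := Ioo_subset_Icc_self hw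
  have hI : ∀ n : ℕ, E (a ^ n) w ∈ Ioo (0 : ℝ) 1 := fun n => hE.mapsTo_Ioo _ hw
  have hanti : Antitone fun n : ℕ => E (a ^ n) w := by
    refine antitone_nat_of_succ_le fun n => ?_
    rw [pow_succ, hE.mul _ _ _ hwI]
    exact (hE.le_iff _ (hE.mapsTo _ hwI) hwI).2 haw.le
  have hbdd : BddBelow (range fun n : ℕ => E (a ^ n) w) := ⟨0, by
    rintro _ ⟨n, rfl⟩; exact (hI n).1.le⟩
  have hlim := tendsto_atTop_ciInf hanti hbdd
  set ℓ := ⨅ n : ℕ, E (a ^ n) w with hℓ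
  have hℓle : ∀ n : ℕ, ℓ ≤ E (a ^ n) w := fun n => ciInf_le hbdd n
  have hℓ0 : 0 ≤ ℓ := le_ciInf fun n => (hI n).1.le
  rcases hℓ0.eq_or_lt with h | h
  · rwa [← h] at hlim
  exfalso
  have hℓI : ℓ ∈ Ioo (0 : ℝ) 1 := ⟨h, (hℓle 0).trans_lt (hI 0).2⟩
  have hcont : ∀ g, Tendsto (fun n : ℕ => E g (E (a ^ n) w)) atTop (𝓝 (E g ℓ)) := fun g =>
    (hE.hasDerivAt g hℓI).continuousAt.tendsto.comp hlim
  refine hfix ℓ hℓI (fun b => ?_) ?_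
  · refine tendsto_nhds_unique (hcont (β b)) (hlim.congr fun n => ?_)
    have := hE.fixed_apply n hwI hwfix b
    rw [zpow_natCast] at this
    exact this.symm
  · refine tendsto_nhds_unique (hcont a) ((hlim.comp (tendsto_add_atTop_nat 1)).congr fun n => ?_)
    rw [Function.comp_apply, pow_succ', hE.mul _ _ _ hwI]

/-- Iterates of `w` in both directions enclose `x` between points fixed by `H`. If `H` moved `x`,
Hölder's theorem would give a nonzero governing function `φ`. The orbit tending to `0` bounds `φ ∘
α⁻ⁿ`, that of `a⁻¹` tending to `1` bounds `φ ∘ αⁿ`, and both bounds are subexponential. -/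
theorem apply_eq_of_fixed_of_lt (hE : TangentAction E a β α) (hB : RationallySpans B)
    (hα : SubexponentialTrivial α)
    (hfix : ∀ x ∈ Ioo (0 : ℝ) 1, (∀ b, E (β b) x = x) → E a x ≠ x) {w : ℝ}
    (hw : w ∈ Ioo (0 : ℝ) 1) (hwfix : ∀ b, E (β b) w = w) (haw : E a w < w) (b : H) {x : ℝ}
    (hx : x ∈ Ioo (0 : ℝ) 1) : E (β b) x = x := by
  by_contra hne
  have hxI := Ioo_subset_Icc_self hx
  have hwI := Ioo_subset_Icc_self hw
  have hlt : ∀ v ∈ Ioo (0 : ℝ) 1, E a v < v → v < E a⁻¹ v := by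
    intro v hv h
    rw [← hE.lt_iff a (Ioo_subset_Icc_self hv) (hE.mapsTo _ (Ioo_subset_Icc_self hv)),
      hE.apply_inv a (Ioo_subset_Icc_self hv)]
    exact h
  have hfix' : ∀ y ∈ Ioo (0 : ℝ) 1, (∀ b, 1 - E (β b) (1 - y) = y) → 1 - E a⁻¹ (1 - y) ≠ y := by
    intro y hy h1 h2
    have hy' : 1 - y ∈ Ioo (0 : ℝ) 1 := by constructor <;> linarith [hy.1, hy.2]
    have h3 : E a⁻¹ (1 - y) = 1 - y := by linarith
    refine hfix (1 - y) hy' (fun b => by linarith [h1 b]) ?_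
    conv_lhs => rw [← h3]
    exact hE.apply_inv a (Ioo_subset_Icc_self hy')
  have hdown : ∀ v ∈ Ioo (0 : ℝ) 1, (∀ b, E (β b) v = v) → E a v < v →
      Tendsto (fun n : ℕ => E (a ^ n) v) atTop (𝓝 0) := fun v hv h1 h2 =>
    hE.tendsto_zero_of_fixed hfix hv h1 h2
  have hup : ∀ v ∈ Ioo (0 : ℝ) 1, (∀ b, E (β b) v = v) → E a v < v →
      Tendsto (fun n : ℕ => 1 - E (a⁻¹ ^ n) (1 - (1 - v))) atTop (𝓝 0) := by
    intro v hv h1 h2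
    refine hE.reverse.inv.tendsto_zero_of_fixed hfix' (w := 1 - v)
      (by constructor <;> linarith [hv.1, hv.2]) (fun b => by simp [h1]) ?_
    have := hlt v hv h2
    simp only [sub_sub_cancel]
    linarith
  have hpow : ∀ k : ℤ, E a (E (a ^ k) w) < E (a ^ k) w := by
    intro k
    rw [← hE.mul _ _ _ hwI, ← zpow_one_add, add_comm, zpow_add_one, hE.mul _ _ _ hwI]
    exact (hE.lt_iff _ (hE.mapsTo _ hwI) hwI).2 haw
  obtain ⟨m, hm⟩ := ((hdown w hw hwfix haw).eventually (gt_mem_nhds hx.1)).exists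
  obtain ⟨m', hm'⟩ := ((hup w hw hwfix haw).eventually
    (gt_mem_nhds (sub_pos.2 hx.2))).exists
  set u := E (a ^ (m : ℤ)) w with hu
  set v := E (a ^ (-(m' : ℤ))) w with hv
  have huI : u ∈ Ioo (0 : ℝ) 1 := hE.mapsTo_Ioo _ hw
  have hvI : v ∈ Ioo (0 : ℝ) 1 := hE.mapsTo_Ioo _ hw
  have hux : u < x := by rw [hu, zpow_natCast]; exact hm
  have hxv : x < v := by
    rw [hv, zpow_neg, zpow_natCast, ← inv_pow]
    rw [sub_sub_cancel] at hm'
    linarith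
  have hufix : ∀ b, E (β b) u = u := hE.fixed_apply _ hwI hwfix
  have hvfix : ∀ b, E (β b) v = v := hE.fixed_apply _ hwI hwfix
  have hone : E (β 0) x = x := by rw [hE.map_zero, hE.one x hxI]
  have hmono : ∀ b c d, E (β b) x ≤ E (β c) x → E (β (b + d)) x ≤ E (β (c + d)) x := by
    intro b c d h
    rw [add_comm b, add_comm c, hE.add, hE.add, hE.mul _ _ _ hxI, hE.mul _ _ _ hxI]
    exact (hE.le_iff _ (hE.mapsTo _ hxI) (hE.mapsTo _ hxI)).2 h
  obtain ⟨φ, hφ0, hφ⟩ := exists_monotone_addMonoidHom hB (fun b => E (β b) x) hmono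
    ⟨b, by rw [hone]; exact hne⟩
  have hφpos : ∀ b, 0 < φ b → x < E (β b) x := by
    intro b hb
    by_contra! hcon
    have h1 := hmono b 0 (-b) (by rw [hone]; exact hcon)
    rw [add_neg_cancel, zero_add] at h1
    have h2 := hφ (-b) h1
    rw [_root_.map_neg] at h2
    linarith
  refine hφ0 (hα φ ?_ ?_)
  -- Reading from the other end reverses the order, so the governing function is `-φ`; the use of
  -- `a⁻¹` replaces `α` by `-α` and turns the past into the future.
  · intro b ε hε
    obtain ⟨C, hC⟩ := hE.reverse.inv.subexponential_of_fixed hB (x := 1 - x) (u := 1 - v)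
      (v := 1 - u) (by constructor <;> linarith [hx.1, hx.2])
      (by constructor <;> linarith [hvI.1, hvI.2]) (by constructor <;> linarith [huI.1, huI.2])
      (by linarith) (by linarith) (by linarith) (hup u huI hufix (hpow _))
      (fun b => by simp [hvfix]) (fun b => by simp [hufix]) (φ := -φ) (fun b hb => by
        have : E (β b) x < x := hE.lt_of_neg hxI hφpos (by simpa using hb)
        simp only [sub_sub_cancel]
        linarith) b hε
    refine ⟨C, fun n => ?_⟩
    have := hC n
    rwa [AddMonoidHom.neg_apply, abs_neg, zsmul_neg, neg_zsmul, neg_neg] at this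
  · intro b ε hε
    exact hE.subexponential_of_fixed hB hxI (Ioo_subset_Icc_self huI) (Ioo_subset_Icc_self hvI)
      hux.le hxv.le (hux.trans hxv) (hdown v hvI hvfix (hpow _)) hufix hvfix hφpos b hε

/-- If the subgroup `H` has a common fixed point in the interior but the group has none, then `H`
acts trivially. -/
theorem apply_eq_of_fixed (hE : TangentAction E a β α) (hB : RationallySpans B)
    (hα : SubexponentialTrivial α)
    (hfix : ∀ x ∈ Ioo (0 : ℝ) 1, (∀ b, E (β b) x = x) → E a x ≠ x) {w : ℝ}
    (hw : w ∈ Ioo (0 : ℝ) 1) (hwfix : ∀ b, E (β b) w = w) (b : H) {x : ℝ}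
    (hx : x ∈ Ioo (0 : ℝ) 1) : E (β b) x = x := by
  have hwI := Ioo_subset_Icc_self hw
  rcases lt_or_gt_of_ne (hfix w hw hwfix) with h | h
  · exact hE.apply_eq_of_fixed_of_lt hB hα hfix hw hwfix h b hx
  · refine hE.inv.apply_eq_of_fixed_of_lt hB hα.neg (fun x hx h1 h2 => hfix x hx h1 ?_) hw hwfix
      ?_ b hx
    · conv_lhs => rw [← h2]
      exact hE.apply_inv a (Ioo_subset_Icc_self hx)
    · have := (hE.lt_iff a⁻¹ hwI (hE.mapsTo _ hwI)).2 h
      rwa [hE.inv_apply a hwI] at this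

/-! ### Actions without common fixed point of `H` -/

/-- The supremum of an `H`-orbit is a common fixed point of `H`, so it cannot lie in the interior.
-/
theorem exists_lt_apply (hE : TangentAction E a β α)
    (hfix : ∀ x ∈ Ioo (0 : ℝ) 1, ∃ b, E (β b) x ≠ x) {x y : ℝ} (hx : x ∈ Ioo (0 : ℝ) 1)
    (hy : y < 1) : ∃ b, y < E (β b) x := by
  by_contra! hcon
  have hxI := Ioo_subset_Icc_self hx
  have hbdd : BddAbove (range fun b => E (β b) x) := ⟨y, by rintro _ ⟨b, rfl⟩; exact hcon b⟩
  set s := ⨆ b, E (β b) x with hs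
  have hle : ∀ b, E (β b) x ≤ s := fun b => le_ciSup hbdd b
  have hsI : s ∈ Ioo (0 : ℝ) 1 :=
    ⟨(hE.mapsTo_Ioo (β 0) hx).1.trans_le (hle 0), (ciSup_le hcon).trans_lt hy⟩
  have hsI' := Ioo_subset_Icc_self hsI
  have h1 : ∀ b, s ≤ E (β b) s := by
    intro b
    refine ciSup_le fun c => ?_
    have h2 : E (β c) x = E (β b) (E (β (-b + c)) x) := by
      rw [← hE.mul _ _ _ hxI, ← hE.add, add_neg_cancel_left]
    rw [h2]
    exact (hE.le_iff _ (hE.mapsTo _ hxI) hsI').2 (hle _)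
  obtain ⟨b, hb⟩ := hfix s hsI
  refine hb (le_antisymm ?_ (h1 b))
  have h2 := (hE.le_iff (β b) hsI' (hE.mapsTo _ hsI')).2 (h1 (-b))
  rwa [hE.map_neg, hE.apply_inv _ hsI'] at h2

theorem exists_apply_lt (hE : TangentAction E a β α)
    (hfix : ∀ x ∈ Ioo (0 : ℝ) 1, ∃ b, E (β b) x ≠ x) {x y : ℝ} (hx : x ∈ Ioo (0 : ℝ) 1)
    (hy : 0 < y) : ∃ b, E (β b) x < y := by
  obtain ⟨b, hb⟩ := hE.reverse.exists_lt_apply (x := 1 - x) (y := 1 - y) (fun z hz => by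
    obtain ⟨b, hb⟩ := hfix (1 - z) (by constructor <;> linarith [hz.1, hz.2])
    exact ⟨b, fun h => hb (by linarith)⟩) (by constructor <;> linarith [hx.1, hx.2])
    (by linarith)
  simp only [sub_sub_cancel] at hb
  exact ⟨b, by linarith⟩

/-- Monotone functions equivariant with respect to the same dense group of translations differ
by a constant. -/
theorem sub_eq_of_equivariant {φ : H →+ ℝ}
    (hdense : ∀ s t : ℝ, s < t → ∃ b, s < φ b ∧ φ b < t) (hE : TangentAction E a β α)
    {F G : ℝ → ℝ} (hF : MonotoneOn F (Ioo 0 1)) (hG : MonotoneOn G (Ioo 0 1))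
    (hFt : ∀ b, ∀ x ∈ Ioo (0 : ℝ) 1, F (E (β b) x) = F x + φ b)
    (hGt : ∀ b, ∀ x ∈ Ioo (0 : ℝ) 1, G (E (β b) x) = G x + φ b) {x y : ℝ}
    (hx : x ∈ Ioo (0 : ℝ) 1) (hy : y ∈ Ioo (0 : ℝ) 1) : G x - F x ≤ G y - F y := by
  by_contra! hcon
  -- Seen through `F`, the translate of `y` by this `b` lies to the right of `x`; seen through `G`,
  -- strictly to the left.
  obtain ⟨b, hb1, hb2⟩ := hdense (F x - F y) (G x - G y) (by linarith)
  have hI := hE.mapsTo_Ioo (β b) hy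
  have h1 : x < E (β b) y := by
    by_contra! h
    have := hF hI hx h
    rw [hFt b y hy] at this
    linarith
  have := hG hx hI h1.le
  rw [hGt b y hy] at this
  linarith

/-- Hölder's theorem for the order of one orbit provides `φ`. `F y` is the supremum of `φ` over the
elements that send the base point to the left of `y`; since orbits are unbounded in both directions,
it is finite. -/
theorem exists_translation (hE : TangentAction E a β α) (hB : RationallySpans B)
    (hfix : ∀ x ∈ Ioo (0 : ℝ) 1, ∃ b, E (β b) x ≠ x) :
    ∃ (φ : H →+ ℝ) (F : ℝ → ℝ), φ ≠ 0 ∧ MonotoneOn F (Ioo 0 1) ∧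
      ∀ b, ∀ x ∈ Ioo (0 : ℝ) 1, F (E (β b) x) = F x + φ b := by
  obtain ⟨x, hx⟩ : ∃ x : ℝ, x ∈ Ioo (0 : ℝ) 1 := ⟨1 / 2, by norm_num, by norm_num⟩
  have hxI := Ioo_subset_Icc_self hx
  have hone : E (β 0) x = x := by rw [hE.map_zero, hE.one x hxI]
  have hmono : ∀ b c d, E (β b) x ≤ E (β c) x → E (β (b + d)) x ≤ E (β (c + d)) x := by
    intro b c d h
    rw [add_comm b, add_comm c, hE.add, hE.add, hE.mul _ _ _ hxI, hE.mul _ _ _ hxI]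
    exact (hE.le_iff _ (hE.mapsTo _ hxI) (hE.mapsTo _ hxI)).2 h
  obtain ⟨b₀, hb₀⟩ := hfix x hx
  obtain ⟨φ, hφ0, hφ⟩ := exists_monotone_addMonoidHom hB (fun b => E (β b) x) hmono
    ⟨b₀, by rw [hone]; exact hb₀⟩
  have hφmono : ∀ b c, E (β b) x ≤ E (β c) x → φ b ≤ φ c := by
    intro b c h
    have h1 := hmono b c (-b) h
    rw [add_neg_cancel] at h1
    have := hφ _ h1
    rw [map_add, _root_.map_neg] at this
    linarith
  set S : ℝ → Set ℝ := fun y => φ '' {b | E (β b) x ≤ y} with hS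
  have hne : ∀ y ∈ Ioo (0 : ℝ) 1, (S y).Nonempty := by
    intro y hy
    obtain ⟨b, hb⟩ := hE.exists_apply_lt hfix hx hy.1
    exact ⟨_, b, hb.le, rfl⟩
  have hbdd : ∀ y ∈ Ioo (0 : ℝ) 1, BddAbove (S y) := by
    intro y hy
    obtain ⟨c, hc⟩ := hE.exists_lt_apply hfix hx hy.2
    refine ⟨φ c, ?_⟩
    rintro _ ⟨b, hb, rfl⟩
    exact hφmono _ _ (le_trans hb hc.le)
  refine ⟨φ, fun y => sSup (S y), hφ0, ?_, ?_⟩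
  · intro y hy z hz hyz
    refine csSup_le_csSup (hbdd z hz) (hne y hy) (image_mono fun b hb => ?_)
    exact le_trans hb hyz
  · have key : ∀ b, ∀ y ∈ Ioo (0 : ℝ) 1, sSup (S y) + φ b ≤ sSup (S (E (β b) y)) := by
      intro b y hy
      rw [← le_sub_iff_add_le]
      refine csSup_le (hne y hy) ?_
      rintro _ ⟨c, hc, rfl⟩
      rw [le_sub_iff_add_le, ← map_add]
      refine le_csSup (hbdd _ (hE.mapsTo_Ioo _ hy)) ⟨c + b, ?_, rfl⟩
      change E (β (c + b)) x ≤ E (β b) y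
      rw [add_comm, hE.add, hE.mul _ _ _ hxI]
      exact (hE.le_iff _ (hE.mapsTo _ hxI) (Ioo_subset_Icc_self hy)).2 hc
    intro b y hy
    refine le_antisymm ?_ (key b y hy)
    have := key (-b) (E (β b) y) (hE.mapsTo_Ioo _ hy)
    rw [hE.map_neg, hE.inv_apply _ (Ioo_subset_Icc_self hy), _root_.map_neg] at this
    linarith

/-- Powers of `α` produce arbitrarily small positive values of `φ`. -/
theorem dense_of_dilate {φ : H →+ ℝ} (hφ0 : φ ≠ 0) {r : ℝ} (hr0 : 0 < r) (hr1 : r ≠ 1)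
    (hα : ∀ b, φ (α b) = r * φ b) {s t : ℝ} (hst : s < t) : ∃ b, s < φ b ∧ φ b < t := by
  obtain ⟨b, hb⟩ := AddMonoidHom.exists_neg_of_ne_zero hφ0
  have hd : Dense (φ.range : Set ℝ) := by
    refine AddSubgroup.dense_of_not_isolated_zero _ fun ε hε => ?_
    have h1 : ∃ k : ℤ, r ^ k * (-φ b) < ε := by
      have hb' : 0 < -φ b := by linarith
      rcases lt_or_gt_of_ne hr1 with h | h
      · obtain ⟨n, hn⟩ := exists_pow_lt_of_lt_one (div_pos hε hb') h
        exact ⟨n, by rw [zpow_natCast]; exact (lt_div_iff₀ hb').1 hn⟩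
      · obtain ⟨n, hn⟩ := exists_pow_lt_of_lt_one (div_pos hε hb') (inv_lt_one_of_one_lt₀ h)
        refine ⟨-n, ?_⟩
        rw [zpow_neg, zpow_natCast, ← inv_pow]
        exact (lt_div_iff₀ hb').1 hn
    obtain ⟨k, hk⟩ := h1
    refine ⟨φ ((k • α) (-b)), ⟨_, rfl⟩, ?_⟩
    rw [apply_zsmul_addAut hr0.ne' hα, _root_.map_neg]
    exact ⟨mul_pos (by positivity) (by linarith), hk⟩
  obtain ⟨_, ⟨b, rfl⟩, h1, h2⟩ := hd.exists_between hst
  exact ⟨b, h1, h2⟩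

/-- If `H` has no common fixed point in the interior, the action is semiconjugate to an affine
action. -/
theorem exists_semiAffine (hE : TangentAction E a β α) (hB : RationallySpans B)
    (hα : SubexponentialTrivial α) (hfix : ∀ x ∈ Ioo (0 : ℝ) 1, ∃ b, E (β b) x ≠ x) :
    ∃ (φ : H →+ ℝ) (F : ℝ → ℝ) (r c : ℝ), 0 < r ∧ r ≠ 1 ∧ SemiAffine E a β α φ F r c := by
  obtain ⟨φ, F, hφ0, hF, hFt⟩ := hE.exists_translation hB hfix
  obtain ⟨x, hx⟩ : ∃ x : ℝ, x ∈ Ioo (0 : ℝ) 1 := ⟨1 / 2, by norm_num, by norm_num⟩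
  have hlt : ∀ b, 0 < φ b → ∀ y ∈ Ioo (0 : ℝ) 1, y < E (β b) y := by
    intro b hb y hy
    by_contra! hcon
    have := hF (hE.mapsTo_Ioo _ hy) hy hcon
    rw [hFt b y hy] at this
    linarith
  -- Conjugation by the increasing map `a` preserves the elements that move points to the right, so
  -- `φ ∘ α` is nonnegative where `φ` is positive.
  obtain ⟨r, hr, hrα⟩ := exists_eq_mul_of_pos_imp_nonneg (φ.comp α.toAddMonoidHom) φ hφ0 (by
    intro b hb
    have hy := hE.mapsTo_Ioo a⁻¹ hx
    have hxI := Ioo_subset_Icc_self hx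
    have h1 := hE.mono a (Ioo_subset_Icc_self hy)
      (hE.mapsTo _ (Ioo_subset_Icc_self hy)) (hlt b hb _ hy)
    rw [← hE.mul a _ _ (Ioo_subset_Icc_self hy), hE.semiconj,
      hE.mul _ _ _ (Ioo_subset_Icc_self hy), hE.apply_inv a hxI] at h1
    have h2 := hF hx (hE.mapsTo_Ioo _ hx) h1.le
    rw [hFt _ x hx] at h2
    change 0 ≤ φ (α b)
    linarith)
  replace hrα : ∀ b, φ (α b) = r * φ b := hrα
  have hr0 : 0 < r := by
    refine lt_of_le_of_ne hr fun h => hφ0 ?_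
    ext b
    have := hrα ((-α) b)
    rw [AddAut.apply_neg_self, ← h, zero_mul] at this
    simpa using this
  have hr1 : r ≠ 1 := by
    rintro rfl
    exact hφ0 (hα.eq_zero_of_invariant fun b => by rw [hrα, one_mul])
  -- `F ∘ a / r` has the same equivariance under `H` as `F`. Uniqueness up to a constant makes `a`
  -- affine.
  have hG : MonotoneOn (fun y => F (E a y) / r) (Ioo 0 1) := by
    intro y hy z hz hyz
    have := hF (hE.mapsTo_Ioo a hy) (hE.mapsTo_Ioo a hz)
      ((hE.le_iff a (Ioo_subset_Icc_self hy) (Ioo_subset_Icc_self hz)).2 hyz)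
    simp only
    gcongr
  have hGt : ∀ b, ∀ y ∈ Ioo (0 : ℝ) 1, F (E a (E (β b) y)) / r = F (E a y) / r + φ b := by
    intro b y hy
    have hyI := Ioo_subset_Icc_self hy
    rw [← hE.mul _ _ _ hyI, hE.semiconj, hE.mul _ _ _ hyI, hFt _ _ (hE.mapsTo_Ioo a hy), hrα]
    field_simp
  have hle : ∀ y ∈ Ioo (0 : ℝ) 1, ∀ z ∈ Ioo (0 : ℝ) 1,
      F (E a y) / r - F y ≤ F (E a z) / r - F z := fun y hy z hz =>
    hE.sub_eq_of_equivariant (fun s t hst => dense_of_dilate hφ0 hr0 hr1 hrα hst) hF hG hFt hGt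
      hy hz
  refine ⟨φ, F, r, F (E a x) - r * F x, hr0, hr1, hφ0, hF, hFt, fun y hy => ?_, hrα⟩
  have h1 := le_antisymm (hle y hy x hx) (hle x hx y hy)
  field_simp at h1
  linarith

/-- A semiconjugacy to an affine action is onto. -/
theorem SemiAffine.surjOn {φ : H →+ ℝ} {F : ℝ → ℝ} {r c : ℝ} (hF : SemiAffine E a β α φ F r c)
    (hE : TangentAction E a β α) (hr0 : 0 < r) (hr1 : r ≠ 1) :
    SurjOn F (Ioo 0 1) univ := by
  obtain ⟨x, hx⟩ : ∃ x : ℝ, x ∈ Ioo (0 : ℝ) 1 := ⟨1 / 2, by norm_num, by norm_num⟩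
  have hbtw : ∀ s t : ℝ, s < t → ∃ y ∈ Ioo (0 : ℝ) 1, s < F y ∧ F y < t := by
    intro s t hst
    obtain ⟨b, hb1, hb2⟩ := dense_of_dilate hF.ne_zero hr0 hr1 hF.dilate
      (s := s - F x) (t := t - F x) (by linarith)
    refine ⟨_, hE.mapsTo_Ioo (β b) hx, ?_, ?_⟩ <;> rw [hF.translation b x hx] <;> linarith
  intro t _
  obtain ⟨y₁, hy₁, -, hF₁⟩ := hbtw (t - 1) t (by linarith)
  obtain ⟨y₂, hy₂, hF₂, -⟩ := hbtw t (t + 1) (by linarith)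
  have hbdd : BddAbove {y ∈ Ioo (0 : ℝ) 1 | F y ≤ t} :=
    ⟨1, fun y hy => hy.1.2.le⟩
  set z := sSup {y ∈ Ioo (0 : ℝ) 1 | F y ≤ t} with hz
  have hz1 : y₁ ≤ z := le_csSup hbdd ⟨hy₁, hF₁.le⟩
  have hz2 : z ≤ y₂ := csSup_le ⟨y₁, hy₁, hF₁.le⟩ fun y hy =>
    (hF.lt_of_lt hy.1 hy₂ (hy.2.trans_lt hF₂)).le
  have hzI : z ∈ Ioo (0 : ℝ) 1 := ⟨hy₁.1.trans_le hz1, hz2.trans_lt hy₂.2⟩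
  refine ⟨z, hzI, le_antisymm ?_ ?_⟩
  · by_contra! hcon
    obtain ⟨y, hy, h1, h2⟩ := hbtw _ _ hcon
    have h3 : z ≤ y := csSup_le ⟨y₁, hy₁, hF₁.le⟩ fun w hw =>
      (hF.lt_of_lt hw.1 hy (hw.2.trans_lt h1)).le
    linarith [hF.monotoneOn hzI hy h3]
  · by_contra! hcon
    obtain ⟨y, hy, h1, h2⟩ := hbtw _ _ hcon
    have h3 : y ≤ z := le_csSup hbdd ⟨hy, h2.le⟩
    linarith [hF.monotoneOn hy hzI h3]

end TangentAction

/-! ### Rational linear algebra: from eigenvalues to growth of additive functions. -/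

/-- A subgroup of a finite dimensional rational vector space is rationally spanned by a linearly
independent family. -/
theorem exists_rationallySpans_of_addSubgroup {V : Type} [AddCommGroup V] [Module ℚ V]
    [FiniteDimensional ℚ V] (H : AddSubgroup V) :
    ∃ (ι : Type) (_ : Fintype ι) (B : ι → H), RationallySpans B ∧
      LinearIndependent ℚ fun i => (B i : V) := by
  obtain ⟨s, hsH, hspan, hli⟩ := exists_linearIndependent ℚ (H : Set V)
  have hfin : Finite s := hli.finite
  have := Fintype.ofFinite s
  refine ⟨s, this, fun i => ⟨i, hsH i.2⟩, fun b => ?_, hli⟩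
  have hb : (b : V) ∈ Submodule.span ℚ (range ((↑) : s → V)) := by
    rw [Subtype.range_coe, hspan]
    exact Submodule.subset_span b.2
  obtain ⟨c, hc⟩ := (Submodule.mem_span_range_iff_exists_fun ℚ).1 hb
  -- The multiplier is a common denominator of the coordinates of `b`.
  refine ⟨∏ i, (c i).den, Finset.prod_pos fun i _ => (c i).den_pos, ?_⟩
  have h1 : ∀ i, ∃ p : ℤ, ((∏ j, (c j).den : ℕ) : ℚ) * c i = p := by
    intro i
    obtain ⟨m, hm⟩ := Finset.dvd_prod_of_mem (fun j => (c j).den) (Finset.mem_univ i)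
    refine ⟨m * (c i).num, ?_⟩
    rw [hm]
    push_cast
    rw [mul_comm ((c i).den : ℚ), mul_assoc, Rat.den_mul_eq_num]
  choose p hp using h1
  refine ⟨p, Subtype.ext ?_⟩
  push_cast
  rw [← hc, Finset.smul_sum]
  refine Finset.sum_congr rfl fun i _ => ?_
  rw [← Int.cast_smul_eq_zsmul ℚ, ← hp, ← Nat.cast_smul_eq_nsmul ℚ, smul_smul]

section Hyperbolic

variable {d : ℕ}

/-- The automorphism of `H` given by `A`. -/
noncomputable def restrictAut (A : GL (Fin d) ℚ) (H : AddSubgroup (Fin d → ℚ))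
    (hAH : ∀ v, (A : Matrix (Fin d) (Fin d) ℚ) *ᵥ v ∈ H ↔ v ∈ H) : AddAut H where
  toFun b := ⟨(A : Matrix (Fin d) (Fin d) ℚ) *ᵥ (b : Fin d → ℚ), (hAH _).2 b.2⟩
  invFun b := ⟨((A⁻¹ : GL (Fin d) ℚ) : Matrix (Fin d) (Fin d) ℚ) *ᵥ (b : Fin d → ℚ),
    (hAH _).1 (by rw [Matrix.mulVec_mulVec, ← Units.val_mul]; simp)⟩
  left_inv b := Subtype.ext (by
    change ((A⁻¹ : GL (Fin d) ℚ) : Matrix (Fin d) (Fin d) ℚ) *ᵥ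
      ((A : Matrix (Fin d) (Fin d) ℚ) *ᵥ (b : Fin d → ℚ)) = (b : Fin d → ℚ)
    rw [Matrix.mulVec_mulVec, ← Units.val_mul]; simp)
  right_inv b := Subtype.ext (by
    change (A : Matrix (Fin d) (Fin d) ℚ) *ᵥ
      (((A⁻¹ : GL (Fin d) ℚ) : Matrix (Fin d) (Fin d) ℚ) *ᵥ (b : Fin d → ℚ)) = (b : Fin d → ℚ)
    rw [Matrix.mulVec_mulVec, ← Units.val_mul]; simp)
  map_add' b c := Subtype.ext
    (Matrix.mulVec_add (A : Matrix (Fin d) (Fin d) ℚ) (b : Fin d → ℚ) (c : Fin d → ℚ))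

/-- The pairing of a rational vector with a complex one. -/
noncomputable def ratPairing (v : Fin d → ℚ) (w : Fin d → ℂ) : ℂ := ∑ j, (v j : ℂ) * w j

theorem ratPairing_mulVec (A : Matrix (Fin d) (Fin d) ℚ) (v : Fin d → ℚ) (w : Fin d → ℂ) :
    ratPairing (A *ᵥ v) w = ratPairing v (w ᵥ* A.map (algebraMap ℚ ℂ)) := by
  simp only [ratPairing, Matrix.mulVec, Matrix.vecMul, dotProduct, Matrix.map_apply,
    eq_ratCast, Rat.cast_sum, Rat.cast_mul, Finset.sum_mul, Finset.mul_sum]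
  rw [Finset.sum_comm]
  refine Finset.sum_congr rfl fun i _ => Finset.sum_congr rfl fun j _ => ?_
  ring

/-- The values of `φ` on an independent, rationally spanning family extend linearly to `ℚ^d`.
Complex coefficients are chosen so that the eigenvector argument applies to `w`. -/
theorem exists_ratPairing_eq {H : AddSubgroup (Fin d → ℚ)} (φ : H →+ ℝ) :
    ∃ w : Fin d → ℂ, ∀ b : H, (φ b : ℂ) = ratPairing (b : Fin d → ℚ) w := by
  obtain ⟨ι, _, B, hB, hli⟩ := exists_rationallySpans_of_addSubgroup H
  obtain ⟨L, hL⟩ := LinearMap.exists_extend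
    ((Module.Basis.span hli).constr ℚ fun i => (φ (B i) : ℂ))
  have hLB : ∀ i, L (B i) = φ (B i) := by
    intro i
    have h1 := (Module.Basis.span hli).constr_basis ℚ (fun i => (φ (B i) : ℂ)) i
    rw [← hL, LinearMap.comp_apply, Submodule.subtype_apply, Module.Basis.span_apply] at h1
    exact h1
  refine ⟨fun j => L (Pi.single j 1), fun b => ?_⟩
  have h1 : ratPairing (b : Fin d → ℚ) (fun j => L (Pi.single j 1)) = L b := by
    rw [LinearMap.pi_apply_eq_sum_univ L b, ratPairing]
    refine Finset.sum_congr rfl fun j _ => ?_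
    rw [Rat.smul_def]
    congr 3
    ext i
    simp [Pi.single_apply, eq_comm]
  rw [h1]
  obtain ⟨q, hq, p, hp⟩ := hB b
  have h2 := congrArg (fun c : H => L (c : Fin d → ℚ)) hp
  have h3 := congrArg (fun c : H => (φ c : ℂ)) hp
  simp only [AddSubgroup.coe_nsmul, AddSubgroup.val_finsetSum, AddSubgroup.coe_zsmul, map_nsmul,
    map_sum, map_zsmul, hLB] at h2
  simp only [map_nsmul, map_sum, map_zsmul, nsmul_eq_mul, zsmul_eq_mul, Complex.ofReal_mul,
    Complex.ofReal_sum, Complex.ofReal_intCast, Complex.ofReal_natCast] at h3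
  simp only [nsmul_eq_mul, zsmul_eq_mul] at h2
  rw [← h2] at h3
  exact mul_left_cancel₀ (by exact_mod_cast hq.ne') h3

/-- A rational matrix without eigenvalue of modulus one acts on a spanning subgroup without
nonzero subexponential additive function. -/
theorem subexponentialTrivial_restrictAut (A : GL (Fin d) ℚ)
    (hA : ∀ z : ℂ, Module.End.HasEigenvalue
      (Matrix.toLin' ((A : Matrix (Fin d) (Fin d) ℚ).map (algebraMap ℚ ℂ))) z → ‖z‖ ≠ 1)
    (H : AddSubgroup (Fin d → ℚ))
    (hAH : ∀ v, (A : Matrix (Fin d) (Fin d) ℚ) *ᵥ v ∈ H ↔ v ∈ H)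
    (hH : Module.finrank ℚ (Submodule.span ℚ (H : Set (Fin d → ℚ))) = d) :
    SubexponentialTrivial (restrictAut A H hAH) := by
  set M := (A : Matrix (Fin d) (Fin d) ℚ).map (algebraMap ℚ ℂ) with hM
  set α := restrictAut A H hAH with hα
  have hstep : ∀ (b : H) w, ratPairing ((α b : H) : Fin d → ℚ) w = ratPairing b (w ᵥ* M) :=
    fun b w => ratPairing_mulVec _ _ _
  have hadd : ∀ v (w w' : Fin d → ℂ),
      ratPairing v (w + w') = ratPairing v w + ratPairing v w' := by
    intro v w w'
    simp [ratPairing, mul_add, Finset.sum_add_distrib]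
  have hsmul : ∀ v (z : ℂ) (w : Fin d → ℂ), ratPairing v (z • w) = z * ratPairing v w := by
    intro v z w
    simp only [ratPairing, Pi.smul_apply, smul_eq_mul, Finset.mul_sum]
    exact Finset.sum_congr rfl fun j _ => by ring
  -- The sign `e = ±1` selects the time direction. The vectors of subexponential growth form a
  -- complex subspace invariant under `M`; it therefore contains an eigenvector as soon as it is
  -- nonzero.
  let P : ℤ → (Fin d → ℂ) → Prop := fun e w => ∀ b : H, ∀ ε : ℝ, 0 < ε →
    ∃ C : ℝ, ∀ n : ℕ, ‖ratPairing (((e * (n : ℤ)) • α) b : H) w‖ ≤ C * Real.exp (ε * n)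
  let S : ℤ → Submodule ℂ (Fin d → ℂ) := fun e =>
    { carrier := {w | P e w}
      zero_mem' := fun b ε hε => ⟨0, fun n => by simp [ratPairing]⟩
      add_mem' := by
        intro w w' h h' b ε hε
        obtain ⟨C, hC⟩ := h b ε hε
        obtain ⟨C', hC'⟩ := h' b ε hε
        refine ⟨C + C', fun n => ?_⟩
        rw [hadd, add_mul]
        exact (norm_add_le _ _).trans (add_le_add (hC n) (hC' n))
      smul_mem' := by
        intro z w h b ε hε
        obtain ⟨C, hC⟩ := h b ε hε
        refine ⟨‖z‖ * C, fun n => ?_⟩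
        rw [hsmul, norm_mul, mul_assoc]
        exact mul_le_mul_of_nonneg_left (hC n) (norm_nonneg _) }
  have hinv : ∀ e, ∀ w ∈ S e, w ᵥ* M ∈ S e := by
    intro e w hw b ε hε
    obtain ⟨C, hC⟩ := hw (α b) ε hε
    refine ⟨C, fun n => ?_⟩
    rw [← hstep]
    have : (α (((e * (n : ℤ)) • α) b) : H) = ((e * (n : ℤ)) • α) (α b) := by
      have h1 : α = (1 : ℤ) • α := (one_zsmul α).symm
      conv_lhs => enter [1]; rw [h1]
      conv_rhs => enter [2, 1]; rw [h1]
      rw [← AddAut.add_apply, ← AddAut.add_apply, ← add_zsmul, ← add_zsmul, add_comm]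
    rw [this]
    exact hC n
  intro φ h1 h2
  obtain ⟨w, hw⟩ := exists_ratPairing_eq φ
  have hwS : w ∈ S 1 ⊓ S (-1) := by
    constructor
    · intro b ε hε
      obtain ⟨C, hC⟩ := h1 b ε hε
      refine ⟨C, fun n => ?_⟩
      rw [← hw, one_mul, Complex.norm_real]
      exact hC n
    · intro b ε hε
      obtain ⟨C, hC⟩ := h2 b ε hε
      refine ⟨C, fun n => ?_⟩
      rw [← hw, neg_one_mul, Complex.norm_real]
      exact hC n
  by_contra hφ
  have hw0 : w ≠ 0 := by
    rintro rfl
    apply hφ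
    ext b
    have := hw b
    simpa [ratPairing] using this
  have : Nontrivial (S 1 ⊓ S (-1) : Submodule ℂ (Fin d → ℂ)) :=
    ⟨⟨w, hwS⟩, 0, fun h => hw0 (congrArg Subtype.val h)⟩
  let T : Module.End ℂ (S 1 ⊓ S (-1) : Submodule ℂ (Fin d → ℂ)) :=
    (Matrix.vecMulLinear M).restrict fun w hw => ⟨hinv 1 w hw.1, hinv (-1) w hw.2⟩
  obtain ⟨z, hz⟩ := Module.End.exists_eigenvalue T
  obtain ⟨⟨u, hu1, hu2⟩, hu⟩ := hz.exists_hasEigenvector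
  have huM : u ᵥ* M = z • u := congrArg Subtype.val hu.apply_eq_smul
  have hu0 : u ≠ 0 := fun h => hu.2 (Subtype.ext h)
  -- `u` is a left eigenvector; the determinant passes from left to right eigenvalues.
  have hev : Module.End.HasEigenvalue (Matrix.toLin' M) z := by
    have hdet : (M - z • (1 : Matrix (Fin d) (Fin d) ℂ)).det = 0 := by
      refine Matrix.exists_vecMul_eq_zero_iff.1 ⟨u, hu0, ?_⟩
      rw [Matrix.vecMul_sub, huM, Matrix.vecMul_smul, Matrix.vecMul_one, sub_self]
    obtain ⟨v, hv0, hv⟩ := Matrix.exists_mulVec_eq_zero_iff.2 hdet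
    refine Module.End.hasEigenvalue_of_hasEigenvector (x := v) ⟨?_, hv0⟩
    rw [Module.End.mem_eigenspace_iff, Matrix.toLin'_apply]
    rwa [Matrix.sub_mulVec, Matrix.smul_mulVec, Matrix.one_mulVec, sub_eq_zero] at hv
  refine hA z hev ?_
  -- Since `H` spans, some `b` detects `u`. Its pairing is multiplied by `z` at each step, so
  -- subexponential growth in the two directions gives `‖z‖ ≤ 1` and `‖z‖ ≥ 1`.
  obtain ⟨b, hb⟩ : ∃ b : H, ratPairing b u ≠ 0 := by
    by_contra! hcon
    apply hu0
    let L : (Fin d → ℚ) →ₗ[ℚ] ℂ :=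
      { toFun := fun v => ratPairing v u
        map_add' := fun v v' => by
          simp [ratPairing, add_mul, Finset.sum_add_distrib]
        map_smul' := fun q v => by
          simp only [ratPairing, Pi.smul_apply, smul_eq_mul, Rat.cast_mul, RingHom.id_apply,
            Rat.smul_def, Finset.mul_sum]
          exact Finset.sum_congr rfl fun j _ => by ring }
    have htop : Submodule.span ℚ (H : Set (Fin d → ℚ)) = ⊤ :=
      Submodule.eq_top_of_finrank_eq (by rw [hH]; simp)
    have hle : Submodule.span ℚ (H : Set (Fin d → ℚ)) ≤ LinearMap.ker L :=
      Submodule.span_le.2 fun v hv => hcon ⟨v, hv⟩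
    rw [htop] at hle
    ext j
    have h3 : L (Pi.single j 1) = 0 := hle (Submodule.mem_top)
    have h4 : L (Pi.single j 1) = u j := by
      change ratPairing _ _ = _
      rw [ratPairing, Finset.sum_eq_single j]
      · simp
      · intro i _ hij
        simp [hij]
      · simp
    rw [← h4, h3]
    rfl
  have hzn : ∀ (n : ℕ) (c : H), ratPairing ((((n : ℤ) • α) c : H) : Fin d → ℚ) u =
      z ^ n * ratPairing c u := by
    intro n
    induction n with
    | zero => simp
    | succ n ih =>
      intro c
      have : (((n + 1 : ℕ) : ℤ) • α) c = ((n : ℤ) • α) (α c) := by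
        push_cast
        rw [add_zsmul, one_zsmul, AddAut.add_apply]
      rw [this, ih, hstep, huM, hsmul, pow_succ, mul_assoc]
  have hbig : ∀ (ρ : ℝ), (∀ ε : ℝ, 0 < ε → ∃ C : ℝ, ∀ n : ℕ, ρ ^ n ≤ C * Real.exp (ε * n)) →
      ρ ≤ 1 := by
    intro ρ h
    by_contra! hρ
    have hlog := Real.log_pos hρ
    obtain ⟨C, hC⟩ := h (Real.log ρ / 2) (by positivity)
    have h3 : Tendsto (fun n : ℕ => Real.exp (Real.log ρ / 2 * n)) atTop atTop :=
      Real.tendsto_exp_atTop.comp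
        (tendsto_natCast_atTop_atTop.const_mul_atTop (by positivity))
    obtain ⟨n, hn⟩ := (h3.eventually (eventually_gt_atTop C)).exists
    have h4 := hC n
    have h5 : ρ ^ n = Real.exp (Real.log ρ / 2 * n) * Real.exp (Real.log ρ / 2 * n) := by
      rw [← Real.exp_add, ← add_mul, add_halves, mul_comm, Real.exp_nat_mul,
        Real.exp_log (by linarith)]
    rw [h5] at h4
    exact absurd (le_of_mul_le_mul_right h4 (Real.exp_pos _)) (not_le.2 hn)
  have hbn := norm_pos_iff.2 hb
  have hcancel : ∀ n : ℕ, z ^ n * ratPairing (((-(n : ℤ)) • α) b : H) u = ratPairing b u := by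
    intro n
    rw [← hzn, ← AddAut.add_apply, ← add_zsmul, add_neg_cancel, zero_zsmul, AddAut.zero_apply]
  have hz0 : 0 < ‖z‖ := by
    rw [norm_pos_iff]
    rintro rfl
    have := hcancel 1
    rw [pow_one, zero_mul] at this
    exact hb this.symm
  refine le_antisymm (hbig _ fun ε hε => ?_) ?_
  · obtain ⟨C, hC⟩ := hu1 b ε hε
    refine ⟨C / ‖ratPairing b u‖, fun n => ?_⟩
    have := hC n
    rw [one_mul, hzn, norm_mul, norm_pow] at this
    rw [div_mul_eq_mul_div, le_div_iff₀ hbn]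
    exact this
  · rw [← inv_inv ‖z‖]
    refine (one_le_inv₀ (inv_pos.2 hz0)).2 (hbig _ fun ε hε => ?_)
    obtain ⟨C, hC⟩ := hu2 b ε hε
    refine ⟨C / ‖ratPairing b u‖, fun n => ?_⟩
    have h3 := hC n
    rw [neg_one_mul] at h3
    rw [div_mul_eq_mul_div, le_div_iff₀ hbn, inv_pow, inv_mul_le_iff₀ (by positivity),
      ← hcancel n, norm_mul, norm_pow]
    exact mul_le_mul_of_nonneg_left h3 (by positivity)

end Hyperbolic

/-! ### From homomorphisms of the semidirect product to tangent actions. -/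

/-- A homomorphism to the group of diffeomorphisms is a `C¹` action. -/
theorem c1Action_realExt {Γ : Type*} [Group Γ] (Φ : Γ →* DiffOnePlus) :
    C1Action fun g => realExt (Φ g : I ≃ₜ I) where
  one x hx := by
    have := realExt_coe (Φ 1 : I ≃ₜ I) ⟨x, hx⟩
    rw [map_one] at this ⊢
    exact this
  mul g h x _ := by
    rw [map_mul]
    exact congrFun (realExt_comp (Φ g : I ≃ₜ I) (Φ h : I ≃ₜ I)) x
  mapsTo g := realExt_mapsTo _
  mono g x hx y hy hxy := by
    have h : StrictMono (Φ g : I ≃ₜ I) := (Φ g).2.1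
    have h1 := h (show (⟨x, hx⟩ : I) < ⟨y, hy⟩ from hxy)
    have h2 := realExt_coe (Φ g : I ≃ₜ I) ⟨x, hx⟩
    have h3 := realExt_coe (Φ g : I ≃ₜ I) ⟨y, hy⟩
    simp only at h2 h3 ⊢
    rw [h2, h3]
    exact h1
  contDiff g := (Φ g).2.2.1

/-- Invariance forces the derivatives of `H` at the end point to be trivial. -/
theorem C1Action.deriv_zero_eq_one {Γ H : Type*} [Group Γ] [AddCommGroup H] {E : Γ → ℝ → ℝ}
    (hE : C1Action E) {a : Γ} {β : H → Γ} {α : AddAut H} (hα : SubexponentialTrivial α)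
    (hadd : ∀ b c, β (b + c) = β b * β c) (hrel : ∀ b, a * β b = β (α b) * a) (b : H) :
    derivWithin (E (β b)) (Icc 0 1) 0 = 1 := by
  have h0 : (0 : ℝ) ∈ Icc (0 : ℝ) 1 := by simp
  have hpos : ∀ g, 0 < derivWithin (E g) (Icc 0 1) 0 := fun g => hE.deriv_pos g h0
  have hmul : ∀ g h, derivWithin (E (g * h)) (Icc 0 1) 0 =
      derivWithin (E g) (Icc 0 1) 0 * derivWithin (E h) (Icc 0 1) 0 := by
    intro g h
    rw [hE.deriv_mul g h h0, hE.zero]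
  -- The logarithm of the derivative at a global fixed point is additive, and conjugation by `a`
  -- does not change it.
  let χ : H →+ ℝ := AddMonoidHom.mk' (fun b => Real.log (derivWithin (E (β b)) (Icc 0 1) 0)) (by
    intro b c
    rw [hadd, hmul, Real.log_mul (hpos _).ne' (hpos _).ne'])
  have h1 : χ = 0 := hα.eq_zero_of_invariant fun b => by
    change Real.log _ = Real.log _
    have h2 := hmul a (β b)
    rw [hrel, hmul, mul_comm] at h2
    rw [mul_left_cancel₀ (hpos a).ne' h2]
  have h2 : Real.log (derivWithin (E (β b)) (Icc 0 1) 0) = 0 := DFunLike.congr_fun h1 b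
  exact Real.eq_one_of_pos_of_log_eq_zero (hpos _) h2

theorem C1Action.tangentAction {Γ H : Type*} [Group Γ] [AddCommGroup H] {E : Γ → ℝ → ℝ}
    (hE : C1Action E) {a : Γ} {β : H → Γ} {α : AddAut H} (hα : SubexponentialTrivial α)
    (hadd : ∀ b c, β (b + c) = β b * β c) (hrel : ∀ b, a * β b = β (α b) * a) :
    TangentAction E a β α where
  toC1Action := hE
  add := hadd
  semiconj := hrel
  deriv_zero := hE.deriv_zero_eq_one hα hadd hrel
  deriv_reverse_zero := hE.reverse.deriv_zero_eq_one hα hadd hrel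

section SemidirectProduct

variable {d : ℕ} (A : GL (Fin d) ℚ) (H : AddSubgroup (Fin d → ℚ))
  (hAH : ∀ v, (A : Matrix (Fin d) (Fin d) ℚ) *ᵥ v ∈ H ↔ v ∈ H)

theorem ofH_add (b c : H) : ofH A H hAH (b + c) = ofH A H hAH b * ofH A H hAH c := by
  apply Subtype.ext
  change SemidirectProduct.inl _ = SemidirectProduct.inl _ * SemidirectProduct.inl _
  rw [← map_mul]
  rfl

theorem genA_mul_ofH (b : H) : genA A H hAH * ofH A H hAH b =
    ofH A H hAH (restrictAut A H hAH b) * genA A H hAH := by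
  have := genA_conj_ofH A H hAH b
  rw [mul_inv_eq_iff_eq_mul] at this
  exact this

theorem exists_eq_ofH_mul_zpow (g : ZSemiSub A H hAH) :
    ∃ (b : H) (k : ℤ), g = ofH A H hAH b * genA A H hAH ^ k := by
  refine ⟨⟨Multiplicative.toAdd (g : ZSemi A).left, g.2⟩,
    Multiplicative.toAdd (g : ZSemi A).right, Subtype.ext ?_⟩
  rw [Subgroup.coe_mul, Subgroup.coe_zpow]
  change (g : ZSemi A) = SemidirectProduct.inl (g : ZSemi A).left *
    (SemidirectProduct.inr (Multiplicative.ofAdd (1 : ℤ))) ^ _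
  rw [← map_zpow, ← ofAdd_zsmul, smul_eq_mul, mul_one, ofAdd_toAdd,
    SemidirectProduct.inl_left_mul_inr_right]

end SemidirectProduct

/-! ### Affine maps -/

/-- The affine map `t ↦ r t + s`. -/
noncomputable def affineOfRatio (r s : ℝ) (hr : 0 < r) : AffPlus :=
  ⟨(LinearEquiv.smulOfNeZero ℝ ℝ r hr.ne').toAffineEquiv.trans (AffineEquiv.constVAdd ℝ ℝ s), by
    intro x y hxy
    change s + r * x < s + r * y
    gcongr⟩

theorem affineOfRatio_apply (r s : ℝ) (hr : 0 < r) (t : ℝ) :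
    (affineOfRatio r s hr : ℝ ≃ᵃ[ℝ] ℝ) t = r * t + s :=
  add_comm s (r * t)

/-- The ratio of an affine map of the line. -/
noncomputable def affRatio (f : AffPlus) : ℝ := (f : ℝ ≃ᵃ[ℝ] ℝ) 1 - (f : ℝ ≃ᵃ[ℝ] ℝ) 0

theorem affRatio_pos (f : AffPlus) : 0 < affRatio f :=
  sub_pos.2 (f.2 zero_lt_one)

theorem affPlus_apply_eq (f : AffPlus) (t : ℝ) :
    (f : ℝ ≃ᵃ[ℝ] ℝ) t = affRatio f * t + (f : ℝ ≃ᵃ[ℝ] ℝ) 0 := by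
  have h : ∀ t : ℝ, (f : ℝ ≃ᵃ[ℝ] ℝ) t = t * (f : ℝ ≃ᵃ[ℝ] ℝ).linear 1 + (f : ℝ ≃ᵃ[ℝ] ℝ) 0 := by
    intro t
    have h1 := (f : ℝ ≃ᵃ[ℝ] ℝ).map_vadd 0 t
    rw [vadd_eq_add, add_zero, vadd_eq_add] at h1
    rw [h1]
    congr 1
    have h2 := (f : ℝ ≃ᵃ[ℝ] ℝ).linear.map_smul t 1
    rwa [smul_eq_mul, mul_one, smul_eq_mul] at h2
  rw [h t, affRatio, h 1]
  ring

theorem affPlus_mul_apply (f g : AffPlus) (t : ℝ) :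
    ((f * g : AffPlus) : ℝ ≃ᵃ[ℝ] ℝ) t = (f : ℝ ≃ᵃ[ℝ] ℝ) ((g : ℝ ≃ᵃ[ℝ] ℝ) t) := rfl

theorem affRatio_mul (f g : AffPlus) : (affRatio (f * g)) = affRatio f * affRatio g := by
  have h1 := affPlus_apply_eq (f * g) 1
  rw [affPlus_mul_apply, affPlus_mul_apply, affPlus_apply_eq f, affPlus_apply_eq g 1,
    affPlus_apply_eq f ((g : ℝ ≃ᵃ[ℝ] ℝ) 0)] at h1
  linarith

/-- The homomorphism sending an affine map to its ratio. -/
noncomputable def affRatioHom : AffPlus →* ℝˣ :=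
  MonoidHom.mk' (fun f => Units.mk0 (affRatio f) (affRatio_pos f).ne') fun f g =>
    Units.ext (affRatio_mul f g)

theorem affRatio_zpow (f : AffPlus) (k : ℤ) : (affRatio (f ^ k)) = affRatio f ^ k := by
  have := congrArg Units.val (map_zpow affRatioHom f k)
  rw [Units.val_zpow_eq_zpow_val] at this
  exact this

/-! ### Conjugacies -/

namespace TangentAction

variable {Γ H ι : Type*} [Group Γ] [AddCommGroup H] [Fintype ι] {a : Γ}
  {β : H → Γ} {α : AddAut H} {B : ι → H} {Φ : Γ →* DiffOnePlus}

theorem map_eq_one (hE : C1Action fun g => realExt (Φ g : I ≃ₜ I)) {g : Γ}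
    (h : ∀ x ∈ Ioo (0 : ℝ) 1, realExt (Φ g : I ≃ₜ I) x = x) : Φ g = 1 := by
  apply Subtype.ext
  ext x
  have h1 := realExt_coe (Φ g : I ≃ₜ I) x
  rw [← h1]
  change realExt (Φ g : I ≃ₜ I) x = x
  rcases x.2.1.eq_or_lt with h0 | h0
  · rw [← h0]; exact hE.zero g
  rcases x.2.2.eq_or_lt with h2 | h2
  · rw [h2]; exact hE.one_eq g
  exact h _ ⟨h0, h2⟩

theorem commute_of_trivial (hgen : ∀ g : Γ, ∃ (b : H) (k : ℤ), g = β b * a ^ k)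
    (h : ∀ b, Φ (β b) = 1) (g g' : Γ) : Φ g * Φ g' = Φ g' * Φ g := by
  obtain ⟨b, k, rfl⟩ := hgen g
  obtain ⟨c, l, rfl⟩ := hgen g'
  simp only [map_mul, h, one_mul, map_zpow, ← zpow_add, add_comm]

/-- A strictly increasing surjection onto the line is an order isomorphism, hence a homeomorphism.
As it is onto, each affine map is determined by the diffeomorphism it comes from, so that `ψ` is
multiplicative. -/
theorem exists_conjugacy_of_affine
    (hE : C1Action fun g => realExt (Φ g : I ≃ₜ I)) {F : ℝ → ℝ}
    (hmono : StrictMonoOn F (Ioo 0 1)) (hsurj : SurjOn F (Ioo 0 1) univ)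
    (haff : ∀ g, ∃ r s : ℝ, 0 < r ∧
      ∀ x ∈ Ioo (0 : ℝ) 1, F (realExt (Φ g : I ≃ₜ I) x) = r * F x + s) :
    ∃ (ψ : Γ →* AffPlus) (F : Ioo (0 : I) 1 ≃ₜ ℝ), IsConjugacy Φ ψ F := by
  have hI : ∀ y : Ioo (0 : I) 1, ((y : I) : ℝ) ∈ Ioo (0 : ℝ) 1 := fun y => ⟨y.2.1, y.2.2⟩
  have hF1 : StrictMono fun y : Ioo (0 : I) 1 => F ((y : I) : ℝ) := fun y z hyz =>
    hmono (hI y) (hI z) hyz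
  have hF2 : Function.Surjective fun y : Ioo (0 : I) 1 => F ((y : I) : ℝ) := by
    intro t
    obtain ⟨x, hx, hxt⟩ := hsurj (mem_univ t)
    exact ⟨⟨⟨x, Ioo_subset_Icc_self hx⟩, hx.1, hx.2⟩, hxt⟩
  let e := hF1.orderIsoOfSurjective _ hF2
  have he : ∀ y : Ioo (0 : I) 1, e y = F ((y : I) : ℝ) := fun y => rfl
  choose r s hr hrs using haff
  have hψ : ∀ g, ∀ y : Ioo (0 : I) 1,
      (affineOfRatio (r g) (s g) (hr g) : ℝ ≃ᵃ[ℝ] ℝ) (e y) =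
        F (realExt (Φ g : I ≃ₜ I) ((y : I) : ℝ)) := by
    intro g y
    rw [affineOfRatio_apply, he, hrs g _ (hI y)]
  have hmem : ∀ g, ∀ y : Ioo (0 : I) 1, (Φ g : I ≃ₜ I) y ∈ Ioo (0 : I) 1 := by
    intro g y
    have := hE.mapsTo_Ioo g (hI y)
    simp only [realExt_coe] at this
    exact ⟨this.1, this.2⟩
  have hψ' : ∀ g, ∀ y : Ioo (0 : I) 1,
      (affineOfRatio (r g) (s g) (hr g) : ℝ ≃ᵃ[ℝ] ℝ) (e y) =
        e ⟨(Φ g : I ≃ₜ I) y, hmem g y⟩ := by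
    intro g y
    rw [hψ, he, realExt_coe]
  refine ⟨MonoidHom.mk' (fun g => affineOfRatio (r g) (s g) (hr g)) ?_, e.toHomeomorph, ?_⟩
  · intro g h
    apply Subtype.ext
    ext t
    obtain ⟨y, rfl⟩ := e.surjective t
    change _ = (affineOfRatio (r g) (s g) (hr g) : ℝ ≃ᵃ[ℝ] ℝ)
      ((affineOfRatio (r h) (s h) (hr h) : ℝ ≃ᵃ[ℝ] ℝ) (e y))
    rw [hψ', hψ', hψ']
    congr 1
    apply Subtype.ext
    simp only [map_mul]
    rfl
  · intro g t
    obtain ⟨y, rfl⟩ := e.surjective t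
    change (Φ g : I ≃ₜ I) (e.symm (e y)) =
      e.symm ((affineOfRatio (r g) (s g) (hr g) : ℝ ≃ᵃ[ℝ] ℝ) (e y))
    rw [hψ', e.symm_apply_apply, e.symm_apply_apply]

/-- Existence of a conjugacy to an affine action. -/
theorem exists_conjugacy (hE : TangentAction (fun g => realExt (Φ g : I ≃ₜ I)) a β α)
    (hB : RationallySpans B) (hα : SubexponentialTrivial α)
    (hgen : ∀ g : Γ, ∃ (b : H) (k : ℤ), g = β b * a ^ k)
    (hfix : ∀ x ∈ Ioo (0 : I) 1, ∃ g, (Φ g : I ≃ₜ I) x ≠ x)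
    (hnonab : ∃ g h, Φ g * Φ h ≠ Φ h * Φ g) :
    ∃ (ψ : Γ →* AffPlus) (F : Ioo (0 : I) 1 ≃ₜ ℝ), IsConjugacy Φ ψ F := by
  have hfix' : ∀ x ∈ Ioo (0 : ℝ) 1, (∀ b, realExt (Φ (β b) : I ≃ₜ I) x = x) →
      realExt (Φ a : I ≃ₜ I) x ≠ x := by
    intro x hx h1 h2
    have hxI := Ioo_subset_Icc_self hx
    obtain ⟨g, hg⟩ := hfix ⟨x, hxI⟩ ⟨hx.1, hx.2⟩
    apply hg
    -- The stabilizer of `x` is a subgroup, so it suffices to fix `x` by `a` and by `H`.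
    have h3 : realExt (Φ g : I ≃ₜ I) x = x := by
      let S : Subgroup Γ :=
        { carrier := {g | realExt (Φ g : I ≃ₜ I) x = x}
          one_mem' := hE.one x hxI
          mul_mem' := fun {g h} hg hh => by
            have := hE.mul g h x hxI
            simp only [mem_ofPred_eq] at hg hh ⊢
            rw [this, hh, hg]
          inv_mem' := fun {g} hg => by
            have := hE.inv_apply g hxI
            simp only [mem_ofPred_eq] at hg this ⊢
            rwa [hg] at this }
      obtain ⟨b, k, rfl⟩ := hgen g
      exact S.mul_mem (h1 b) (S.zpow_mem h2 k)
    apply Subtype.ext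
    rw [← realExt_coe]
    exact h3
  by_cases hH : ∃ w ∈ Ioo (0 : ℝ) 1, ∀ b, realExt (Φ (β b) : I ≃ₜ I) w = w
  · obtain ⟨w, hw, hwfix⟩ := hH
    have h1 : ∀ b, Φ (β b) = 1 := fun b => map_eq_one hE.toC1Action fun x hx =>
      hE.apply_eq_of_fixed hB hα hfix' hw hwfix b hx
    obtain ⟨g, h, hgh⟩ := hnonab
    exact absurd (commute_of_trivial hgen h1 g h) hgh
  · push Not at hH
    obtain ⟨φ, F, r, c, hr0, hr1, hF⟩ := hE.exists_semiAffine hB hα hH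
    refine exists_conjugacy_of_affine hE.toC1Action (hF.strictMonoOn hE hB hr0 hr1)
      (hF.surjOn hE hr0 hr1) ?_
    let S : Subgroup Γ :=
      { carrier := {g | ∃ r s : ℝ, 0 < r ∧
          ∀ x ∈ Ioo (0 : ℝ) 1, F (realExt (Φ g : I ≃ₜ I) x) = r * F x + s}
        one_mem' := ⟨1, 0, one_pos, fun x hx => by
          have := hE.one x (Ioo_subset_Icc_self hx)
          rw [this]; ring⟩
        mul_mem' := by
          rintro g h ⟨r, s, hr, hrs⟩ ⟨r', s', hr', hrs'⟩
          refine ⟨r * r', r * s' + s, mul_pos hr hr', fun x hx => ?_⟩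
          have h1 := hE.mul g h x (Ioo_subset_Icc_self hx)
          rw [h1, hrs _ (hE.mapsTo_Ioo h hx), hrs' x hx]
          ring
        inv_mem' := by
          rintro g ⟨r, s, hr, hrs⟩
          refine ⟨r⁻¹, -(r⁻¹ * s), inv_pos.2 hr, fun x hx => ?_⟩
          have h1 := hE.apply_inv g (Ioo_subset_Icc_self hx)
          have h2 := hrs _ (hE.mapsTo_Ioo g⁻¹ hx)
          rw [h1] at h2
          rw [h2]
          field_simp
          ring }
    intro g
    obtain ⟨b, k, rfl⟩ := hgen g
    exact S.mul_mem (show β b ∈ S from ⟨1, φ b, one_pos, fun x hx => by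
      rw [one_mul]; exact hF.translation b x hx⟩)
      (S.zpow_mem (show a ∈ S from ⟨r, c, hr0, hF.affine⟩) k)

/-- A parametrization of the interval that turns the action into an affine one yields a
semiconjugacy. -/
theorem semiAffine_invFun {E : Γ → ℝ → ℝ} {f : ℝ → ℝ} (hf : StrictMono f)
    (hrange : ∀ x ∈ Ioo (0 : ℝ) 1, ∃ t, f t = x) {φ : H →+ ℝ} (hφ : φ ≠ 0) {r c : ℝ}
    (hβ : ∀ b t, E (β b) (f t) = f (t + φ b)) (ha : ∀ t, E a (f t) = f (r * t + c))
    (hα : ∀ b, φ (α b) = r * φ b) : SemiAffine E a β α φ (Function.invFun f) r c := by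
  have hinv : ∀ t, Function.invFun f (f t) = t := Function.leftInverse_invFun hf.injective
  refine ⟨hφ, ?_, ?_, ?_, hα⟩
  · intro x hx y hy hxy
    obtain ⟨s, rfl⟩ := hrange x hx
    obtain ⟨t, rfl⟩ := hrange y hy
    rw [hinv, hinv]
    exact hf.le_iff_le.1 hxy
  · intro b x hx
    obtain ⟨s, rfl⟩ := hrange x hx
    rw [hβ, hinv, hinv]
  · intro x hx
    obtain ⟨s, rfl⟩ := hrange x hx
    rw [ha, hinv, hinv]

/-- An element conjugate to an affine map of ratio different from `1` has a single fixed point in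
the interior, with derivative equal to the ratio. -/
theorem hasInteriorMultiplier (hE : TangentAction (fun g => realExt (Φ g : I ≃ₜ I)) a β α)
    (hB : RationallySpans B) {f : ℝ → ℝ} (hf : StrictMono f ∨ StrictAnti f)
    (hfI : ∀ t, f t ∈ Ioo (0 : ℝ) 1)
    (hrange : ∀ x ∈ Ioo (0 : ℝ) 1, ∃ t, f t = x) {φ : H →+ ℝ} (hφ : φ ≠ 0) {r c : ℝ}
    (hr0 : 0 < r) (hr1 : r ≠ 1)
    (hβ : ∀ b t, realExt (Φ (β b) : I ≃ₜ I) (f t) = f (t + φ b))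
    (ha : ∀ t, realExt (Φ a : I ≃ₜ I) (f t) = f (r * t + c))
    (hα : ∀ b, φ (α b) = r * φ b) : HasInteriorMultiplier (Φ a) r := by
  have hinj : Function.Injective f := hf.elim StrictMono.injective StrictAnti.injective
  have h1r : 1 - r ≠ 0 := sub_ne_zero.2 hr1.symm
  have hfixed : ∀ t, realExt (Φ a : I ≃ₜ I) (f t) = f t ↔ t = c / (1 - r) := by
    intro t
    rw [ha, hinj.eq_iff, eq_div_iff h1r]
    constructor <;> intro h <;> linarith
  have hderiv : derivWithin (realExt (Φ a : I ≃ₜ I)) (Icc 0 1) (f (c / (1 - r))) = r := by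
    rcases hf with hf | hf
    · exact (semiAffine_invFun (E := fun g : Γ => realExt (Φ g : I ≃ₜ I)) hf hrange hφ hβ ha
        hα).deriv_fixed hE hB hr0 hr1 (hfI _)
        ((hfixed _).2 rfl)
    -- A conjugacy may reverse orientation. Precomposition with `t ↦ -t` makes it increasing,
    -- changes the signs of `φ` and `c`, and keeps the ratio.
    · have hF : SemiAffine (fun g : Γ => realExt (Φ g : I ≃ₜ I)) a β α (-φ)
          (Function.invFun fun t => f (-t)) r (-c) := by
        refine semiAffine_invFun (fun s t hst => hf (neg_lt_neg hst)) (fun x hx => ?_)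
          (neg_ne_zero.2 hφ) (fun b t => ?_) (fun t => ?_) (fun b => ?_)
        · obtain ⟨t, ht⟩ := hrange x hx
          exact ⟨-t, by rw [neg_neg]; exact ht⟩
        · simp only [AddMonoidHom.neg_apply]
          rw [hβ]
          congr 1
          ring
        · rw [ha]
          congr 1
          ring
        · simp only [AddMonoidHom.neg_apply, hα]
          ring
      exact hF.deriv_fixed hE hB hr0 hr1 (hfI _) ((hfixed _).2 rfl)
  have hp := hfI (c / (1 - r))
  refine ⟨⟨f (c / (1 - r)), Ioo_subset_Icc_self hp⟩, ⟨hp.1, hp.2⟩, fun y hy => ?_, ?_⟩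
  · obtain ⟨t, ht⟩ := hrange (y : ℝ) ⟨hy.1, hy.2⟩
    rw [Subtype.ext_iff, Subtype.ext_iff, ← realExt_coe, ← ht, hfixed, hinj.eq_iff]
  · have := hE.hasDerivAt a hp
    rwa [hderiv] at this

/-- Rigidity of the multipliers: every conjugacy to an affine action sends `a` to a homothety, and
the ratios of the affine maps are the derivatives at the interior fixed points. -/
theorem multipliers_of_conjugacy (hE : TangentAction (fun g => realExt (Φ g : I ≃ₜ I)) a β α)
    (hB : RationallySpans B) (hα : SubexponentialTrivial α)
    (hgen : ∀ g : Γ, ∃ (b : H) (k : ℤ), g = β b * a ^ k)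
    (hnonab : ∃ g h, Φ g * Φ h ≠ Φ h * Φ g) {ψ : Γ →* AffPlus} {F : Ioo (0 : I) 1 ≃ₜ ℝ}
    (hconj : IsConjugacy Φ ψ F) :
    ∃ r : ℝ, IsHomothetyOfRatio (ψ a) r ∧
      ∀ k : ℤ, k ≠ 0 → ∀ b : H, HasInteriorMultiplier (Φ (a ^ k * β b)) (r ^ k) := by
  set f : ℝ → ℝ := fun t => ((F.symm t : I) : ℝ) with hfdef
  have hfI : ∀ t, f t ∈ Ioo (0 : ℝ) 1 := fun t => ⟨(F.symm t).2.1, (F.symm t).2.2⟩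
  have hrange : ∀ x ∈ Ioo (0 : ℝ) 1, ∃ t, f t = x := by
    intro x hx
    refine ⟨F ⟨⟨x, Ioo_subset_Icc_self hx⟩, hx.1, hx.2⟩, ?_⟩
    simp [hfdef]
  have hinj : Function.Injective f := fun s t hst =>
    F.symm.injective (Subtype.ext (Subtype.ext hst))
  have hcont : Continuous f :=
    continuous_subtype_val.comp (continuous_subtype_val.comp F.symm.continuous)
  have hf : StrictMono f ∨ StrictAnti f := hcont.strictMono_of_inj hinj
  have hact : ∀ g t, realExt (Φ g : I ≃ₜ I) (f t) = f ((ψ g : ℝ ≃ᵃ[ℝ] ℝ) t) := by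
    intro g t
    simp only [hfdef]
    rw [realExt_coe, hconj g t]
  -- The logarithm of the ratio on `H` is additive and `α`-invariant, so it vanishes: `H` acts by
  -- translations, whose lengths form `φ` below.
  let χ : H →+ ℝ := AddMonoidHom.mk' (fun b => Real.log (affRatio (ψ (β b)))) (by
    intro b c
    rw [hE.add, map_mul, affRatio_mul,
      Real.log_mul (affRatio_pos _).ne' (affRatio_pos _).ne'])
  have hχ : χ = 0 := hα.eq_zero_of_invariant fun b => by
    change Real.log _ = Real.log _
    have h2 := congrArg (fun g => (affRatio (ψ g))) (hE.semiconj b)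
    simp only [map_mul, affRatio_mul] at h2
    rw [mul_comm] at h2
    rw [mul_right_cancel₀ (affRatio_pos _).ne' h2]
  have hρ : ∀ b, (affRatio (ψ (β b))) = 1 := fun b =>
    Real.eq_one_of_pos_of_log_eq_zero (affRatio_pos _) (DFunLike.congr_fun hχ b)
  have hψβ : ∀ b t, (ψ (β b) : ℝ ≃ᵃ[ℝ] ℝ) t = t + (ψ (β b) : ℝ ≃ᵃ[ℝ] ℝ) 0 := by
    intro b t
    rw [affPlus_apply_eq, hρ, one_mul]
  let φ : H →+ ℝ := AddMonoidHom.mk' (fun b => (ψ (β b) : ℝ ≃ᵃ[ℝ] ℝ) 0) (by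
    intro b c
    rw [hE.add, map_mul, affPlus_mul_apply, hψβ, add_comm])
  have hβ : ∀ b t, realExt (Φ (β b) : I ≃ₜ I) (f t) = f (t + φ b) := by
    intro b t
    rw [hact, hψβ]
    rfl
  -- Otherwise `H` would act trivially and the image would be cyclic, hence Abelian.
  have hφ0 : φ ≠ 0 := by
    intro h0
    obtain ⟨g, h, hgh⟩ := hnonab
    refine hgh (commute_of_trivial hgen (fun b => map_eq_one hE.toC1Action fun x hx => ?_) g h)
    obtain ⟨t, rfl⟩ := hrange x hx
    rw [hβ, h0, AddMonoidHom.zero_apply, add_zero]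
  have hdil : ∀ b, φ (α b) = (affRatio (ψ a)) * φ b := by
    intro b
    have h1 := congrArg (fun g => (ψ g : ℝ ≃ᵃ[ℝ] ℝ) 0) (hE.semiconj b)
    simp only [map_mul, affPlus_mul_apply] at h1
    rw [hψβ (α b), affPlus_apply_eq (ψ a) ((ψ (β b) : ℝ ≃ᵃ[ℝ] ℝ) 0)] at h1
    change (ψ (β (α b)) : ℝ ≃ᵃ[ℝ] ℝ) 0 = (affRatio (ψ a)) * (ψ (β b) : ℝ ≃ᵃ[ℝ] ℝ) 0
    linarith
  have hr0 := affRatio_pos (ψ a)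
  have hr1 : (affRatio (ψ a)) ≠ 1 := by
    intro h1
    exact hφ0 (hα.eq_zero_of_invariant fun b => by rw [hdil, h1, one_mul])
  refine ⟨(affRatio (ψ a)), ⟨hr0, hr1, (ψ a : ℝ ≃ᵃ[ℝ] ℝ) 0 / (1 - (affRatio (ψ a))), fun t => ?_⟩,
    fun k hk b => ?_⟩
  · rw [affPlus_apply_eq]
    have : 1 - (affRatio (ψ a)) ≠ 0 := sub_ne_zero.2 hr1.symm
    field_simp
    ring
  -- `aᵏ b` acts on `H` by `αᵏ` and on the line with ratio `rᵏ ≠ 1`, so the argument for `a` applies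
  -- to it.
  · refine (hE.zpow_mul k b).hasInteriorMultiplier hB hf hfI hrange hφ0 (zpow_pos hr0 k)
      (fun h => ?_) hβ (c := (ψ (a ^ k * β b) : ℝ ≃ᵃ[ℝ] ℝ) 0) (fun t => ?_)
      (apply_zsmul_addAut hr0.ne' hdil k)
    · rcases (zpow_eq_one_iff_of_ne_zero₀ hk).1 h with h | h
      · exact hr1 h
      · linarith [h.1]
    · rw [hact, affPlus_apply_eq, map_mul, affRatio_mul, hρ, mul_one, map_zpow,
        affRatio_zpow]

end TangentAction

theorem mainTheorem2 {d : ℕ} (A : GL (Fin d) ℚ)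
    (hA : ∀ z : ℂ, Module.End.HasEigenvalue
      (Matrix.toLin' ((A : Matrix (Fin d) (Fin d) ℚ).map (algebraMap ℚ ℂ))) z → ‖z‖ ≠ 1)
    (H : AddSubgroup (Fin d → ℚ))
    (hAH : ∀ v, (A : Matrix (Fin d) (Fin d) ℚ) *ᵥ v ∈ H ↔ v ∈ H)
    (hH : Module.finrank ℚ (Submodule.span ℚ (H : Set (Fin d → ℚ))) = d)
    (Φ : ZSemiSub A H hAH →* DiffOnePlus)
    (hfix : ∀ x ∈ Ioo (0 : I) 1, ∃ g, (Φ g : I ≃ₜ I) x ≠ x)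
    (hnonab : ∃ g h, Φ g * Φ h ≠ Φ h * Φ g) :
    (∃ (ψ : ZSemiSub A H hAH →* AffPlus) (F : Ioo (0 : I) 1 ≃ₜ ℝ), IsConjugacy Φ ψ F) ∧
    ∀ (ψ : ZSemiSub A H hAH →* AffPlus) (F : Ioo (0 : I) 1 ≃ₜ ℝ), IsConjugacy Φ ψ F →
      ∃ r : ℝ, IsHomothetyOfRatio (ψ (genA A H hAH)) r ∧
        HasInteriorMultiplier (Φ (genA A H hAH)) r ∧
        ∀ k : ℤ, k ≠ 0 → ∀ b : H,
          HasInteriorMultiplier (Φ (genA A H hAH ^ k * ofH A H hAH b)) (r ^ k) := by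
  have hα := subexponentialTrivial_restrictAut A hA H hAH hH
  obtain ⟨ι, _, B, hB, -⟩ := exists_rationallySpans_of_addSubgroup H
  have hE := (c1Action_realExt Φ).tangentAction hα (ofH_add A H hAH) (genA_mul_ofH A H hAH)
  have hgen := exists_eq_ofH_mul_zpow A H hAH
  refine ⟨hE.exists_conjugacy hB hα hgen hfix hnonab, fun ψ F hconj => ?_⟩
  obtain ⟨r, hr, hmult⟩ := hE.multipliers_of_conjugacy hB hα hgen hnonab hconj
  refine ⟨r, hr, ?_, hmult⟩
  have h1 := hmult 1 one_ne_zero 0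
  rwa [hE.map_zero, mul_one, zpow_one, zpow_one] at h1
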